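/- Let $X$ be a finite connected undirected plane (multi)graph with nonnegative edge lengths, and let $F$ be a face of $X$ bounded by a simple cycle, all other faces of $X$ being triangles. The vertices of $F$ are the sites; each site $s$ has a weight $\omega(s)\ge 0$, and the additive distance from $s$ to a vertex $v$ is $\omega(s)+\mathrm{dist}(s,v)$. Assume that no vertex has equal additive distances to two different sites, and that every site is closer to itself than to any other site (every Voronoi cell is non-empty). Split the sites, in their cyclic order along $F$, into two contiguous sets: green sites $g_1,\dots,g_p$, listed in the order along $F$, with $p\ge 2$, and red sites $r_1,\dots,r_q$ with $q\ge 1$ (in particular this covers $p=q=k/2$ where $k=|F|$ is even, $k>3$; then $g_p=g_{k/2}$). Let $X'$ be obtained from $X$ by adding inside $F$ an artificial edge of infinite length between $g_1$ and $g_p$, which splits $F$ into a face $F'$ whose vertices are exactly the green sites and a second face $F''$, and by triangulating $F''$ with further artificial edges of infinite length. Let $\mathsf{VD}^*(G)$ be the dual Voronoi diagram of the green sites in $X'$. That is, take the duals of the edges of $X'$ whose endpoints lie in different green Voronoi cells, replace the dual vertex of $F'$ by one copy (a leaf) for each incident edge, and contract at vertices of degree two. Its vertices are the leaves and the trichromatic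 faces (triangles whose three vertices lie in three different green cells); its edges are the contracted dual paths, called Voronoi edges. Deletion step: delete every artificial vertex of $\mathsf{VD}^*(G)$ (the leaf at the artificial edge $g_1g_p$, and the trichromatic faces of $X'$ that are not faces of $X$). Delete also every vertex of $\mathsf{VD}^*(G)$ whose face (for a leaf: whose edge of $F'$) has a vertex $v$ with smaller additive distance to its closest red site than to its closest green site. A Voronoi edge is dangling if one of its endpoints is deleted and the other is not; it belongs to the surviving connected component of its surviving endpoint, and it is associated with the two green sites whose cells lie on its two sides. Then: 1. each surviving connected component of $\mathsf{VD}^*(G)$ contains at most one dangling edge; 2. each of $g_1$ and $g_p$ is associated with exactly one dangling edge, and every other green site is associated with either zero or two dangling edges. -/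

import Mathlib

open scoped NNReal ENNReal

/-- A finite connected plane multigraph, given by its rotation system.  `D` is the set of darts
(oriented edges), `rev` reverses a dart, `src d` is the tail of `d`, and `rot` maps each dart to the
next dart in counterclockwise order around its tail.  The faces are the cycles of `rot⁻¹ * rev`
(walk along a dart, keeping the face on the left).  The embedding is on the sphere:
`|V| - |E| + |faces| = 2`, where `|D| = 2 |E|`. -/
structure PlaneMap (V D : Type*) where
  rev : Equiv.Perm D
  rot : Equiv.Perm D
  src : D → V
  rev_rev : ∀ d, rev (rev d) = d
  rev_ne : ∀ d, rev d ≠ d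
  src_surjective : Function.Surjective src
  src_eq_iff : ∀ d e, src d = src e ↔ rot.SameCycle d e
  connected : ∀ u v, Relation.ReflTransGen (fun x y => ∃ d, src d = x ∧ src (rev d) = y) u v
  euler : 2 * Nat.card V + 2 * Nat.card (Quotient (Equiv.Perm.SameCycle.setoid (rot⁻¹ * rev)))
    = Nat.card D + 4

namespace PlaneMap

variable {V D : Type*} (M : PlaneMap V D)

/-- The next dart along the face on the left of a dart. -/
def next : Equiv.Perm D := M.rot⁻¹ * M.rev

/-- Faces, that is, vertices of the planar dual. -/
def Face : Type _ := Quotient (Equiv.Perm.SameCycle.setoid M.next)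

/-- The face on the left of a dart. -/
def face (d : D) : M.Face := Quotient.mk (Equiv.Perm.SameCycle.setoid M.next) d

/-- The darts on the boundary of a face; their tails are the vertices of the face. -/
def faceDarts (f : M.Face) : Set D := {d | M.face d = f}

def IsTriangle (f : M.Face) : Prop := (M.faceDarts f).ncard = 3

/-- `M.IsWalk u l v`: the list of darts `l` is a walk from `u` to `v`. -/
inductive IsWalk : V → List D → V → Prop
  | nil (v : V) : IsWalk v [] v
  | cons (d : D) {l : List D} {w : V} (h : IsWalk (M.src (M.rev d)) l w) :
      IsWalk (M.src d) (d :: l) w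

/-- Shortest path distance for the lengths `len` (edges may have infinite length). -/
noncomputable def dist (len : D → ℝ≥0∞) (u v : V) : ℝ≥0∞ :=
  ⨅ (l : List D) (_ : M.IsWalk u l v), (l.map len).sum

/-- The `i`-th vertex (counted from `0`) along the boundary of the face of `d₀`, starting at the
tail of `d₀`. -/
def bdry (d₀ : D) (i : ℕ) : V := M.src (M.next^[i] d₀)

end PlaneMap

/-- The input of an additively weighted Voronoi diagram in the plane graph `M`: edge lengths,
a set of sites with additive weights, and the face (the hole) whose vertices are the sites. -/
structure VoronoiInput {V D : Type*} (M : PlaneMap V D) where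
  len : D → ℝ≥0∞
  weight : V → ℝ≥0
  sites : Set V
  hole : M.Face

namespace VoronoiInput

variable {V D : Type*} {M : PlaneMap V D} (I : VoronoiInput M)

/-- Additive distance from the site `s` to the vertex `v`. -/
noncomputable def wdist (s v : V) : ℝ≥0∞ := I.weight s + M.dist I.len s v

/-- The Voronoi cell of `s`: the vertices closer to `s` than to any other site. -/
def cell (s : V) : Set V := {v | s ∈ I.sites ∧ ∀ t ∈ I.sites, t ≠ s → I.wdist s v < I.wdist t v}

/-- Additive distances are unique: no vertex has the same distance to two different sites. -/
def NoTies : Prop := ∀ s ∈ I.sites, ∀ t ∈ I.sites, s ≠ t → ∀ v, I.wdist s v ≠ I.wdist t v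

def SameCell (u v : V) : Prop := ∃ s ∈ I.sites, u ∈ I.cell s ∧ v ∈ I.cell s

/-- Darts whose two endpoints are in different cells; the duals of their edges form the subgraph of
the planar dual from which the dual Voronoi diagram is obtained. -/
def Bichromatic (d : D) : Prop := ¬ I.SameCell (M.src d) (M.src (M.rev d))

/-- A triangular face other than the hole whose three vertices are in three different cells. -/
def Trichromatic (f : M.Face) : Prop :=
  f ≠ I.hole ∧ M.IsTriangle f ∧
    ∀ d ∈ M.faceDarts f, ∀ e ∈ M.faceDarts f, d ≠ e → ¬ I.SameCell (M.src d) (M.src e)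

/-- The vertices of the dual Voronoi diagram: one copy of the hole (a leaf) for each bichromatic
edge on its boundary, and the trichromatic faces. -/
inductive Node : Type _
  | leaf (d : D) (h : M.face d = I.hole ∧ I.Bichromatic d) : Node
  | tri (f : M.Face) (h : I.Trichromatic f) : Node

/-- The darts of the face of a node (of a leaf: only the dart of that copy of the hole). -/
def Node.darts : I.Node → Set D
  | .leaf d _ => {d}
  | .tri f _ => M.faceDarts f

/-- Two bichromatic darts are linked if they are the two darts of one edge, or if they lie on a
common face that is neither the hole nor trichromatic, that is, on a vertex of degree two of the
bichromatic subgraph of the dual. -/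
def Link (d e : {d : D // I.Bichromatic d}) : Prop :=
  e.1 = M.rev d.1 ∨
    (M.face d.1 = M.face e.1 ∧ M.face d.1 ≠ I.hole ∧ ¬ I.Trichromatic (M.face d.1))

/-- The edges of the dual Voronoi diagram: what remains of the bichromatic dual edges after
contraction at the vertices of degree two (classes of the equivalence relation generated by
`Link`). -/
def VEdge : Type _ := Quot I.Link

/-- The node `n` is an endpoint of the Voronoi edge `E`. -/
def IsEnd (E : I.VEdge) (n : I.Node) : Prop :=
  ∃ d : {d : D // I.Bichromatic d}, Quot.mk I.Link d = E ∧ d.1 ∈ n.darts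

/-- The cell of the site `s` lies on one of the two sides of the Voronoi edge `E`: the site `s` is
associated with `E`.  (A class of darts is closed under `rev`, so tails see both sides.) -/
def Associated (E : I.VEdge) (s : V) : Prop :=
  ∃ d : {d : D // I.Bichromatic d}, Quot.mk I.Link d = E ∧ M.src d.1 ∈ I.cell s

/-- The dual Voronoi diagram as a graph on its nodes. -/
def graph : SimpleGraph I.Node where
  Adj n m := n ≠ m ∧ ∃ E, I.IsEnd E n ∧ I.IsEnd E m
  symm := ⟨fun _ _ h => ⟨h.1.symm, h.2.elim fun E hE => ⟨E, hE.2, hE.1⟩⟩⟩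
  loopless := ⟨fun _ h => h.1 rfl⟩

/-- A Voronoi edge is dangling if one endpoint is deleted and the other is not. -/
def IsDangling (deleted : Set I.Node) (E : I.VEdge) : Prop :=
  (∃ n, I.IsEnd E n ∧ n ∈ deleted) ∧ ∃ n, I.IsEnd E n ∧ n ∉ deleted

/-- The dangling edges contained in a connected component that survives the deletion: those whose
surviving endpoint is in the component. -/
def danglingOf (deleted : Set I.Node)
    (c : (I.graph.induce deletedᶜ).ConnectedComponent) : Set I.VEdge :=
  {E | I.IsDangling deleted E ∧ ∃ n : ↥(deletedᶜ), I.IsEnd E n.1 ∧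
    (I.graph.induce deletedᶜ).connectedComponentMk n = c}

end VoronoiInput

/-- `X'` arises from `X` by adding artificial edges inside the face `F` of the dart `d₀`.  Let
`s₀, s₁, …` be the vertices of `F` in the order of its boundary walk, starting at the tail of `d₀`.
The artificial dart `a` goes from `s_{p-1}` to `s₀` and splits `F` into a face with vertices
`s₀, …, s_{p-1}` (the face of `a`) and another one, which is triangulated by further artificial
edges.  The injection `emb` identifies the darts of `X` with those of `X'` that are not
artificial. -/
structure IsAugmentation {V D D' : Type*} (X : PlaneMap V D) (X' : PlaneMap V D') (emb : D ↪ D')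
    (d₀ : D) (p : ℕ) (a : D') : Prop where
  src_emb : ∀ d, X'.src (emb d) = X.src d
  rev_emb : ∀ d, X'.rev (emb d) = emb (X.rev d)
  /-- Omitting the artificial darts from the rotations of `X'` gives the rotations of `X`. -/
  rot_emb : ∀ d, ∃ n : ℕ, X'.rot^[n + 1] (emb d) = emb (X.rot d) ∧
    ∀ j < n, X'.rot^[j + 1] (emb d) ∉ Set.range emb
  /-- All faces of `X` other than `F` remain faces of `X'`. -/
  next_emb : ∀ d, X.face d ≠ X.face d₀ → X'.next (emb d) = emb (X.next d)
  artificial : a ∉ Set.range emb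
  /-- The boundary of the face of `a`: the darts of `F` from `s₀` to `s_{p-1}`, followed by `a`. -/
  next_bdry : ∀ i, i + 2 < p → X'.next (emb (X.next^[i] d₀)) = emb (X.next^[i + 1] d₀)
  next_last : X'.next (emb (X.next^[p - 2] d₀)) = a
  next_a : X'.next a = emb d₀
  /-- Artificial edges connect two different vertices. -/
  not_loop : ∀ e, e ∉ Set.range emb → X'.src e ≠ X'.src (X'.rev e)
  triangulated : ∀ f, f ≠ X'.face a → X'.IsTriangle f

section Merge

variable {V D D' : Type*} (X : PlaneMap V D) (X' : PlaneMap V D') (emb : D ↪ D')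
  (len : D → ℝ≥0) (weight : V → ℝ≥0) (d₀ : D) (p q : ℕ) (a : D')

/-- The green sites: the first `p` vertices of the face of `d₀`. -/
def greenSites : Set V := {v | ∃ i < p, v = X.bdry d₀ i}

/-- The red sites: the following `q` vertices of the face of `d₀`. -/
def redSites : Set V := {v | ∃ i < q, v = X.bdry d₀ (p + i)}

/-- The Voronoi diagram in `X` of all vertices of the face of `d₀`. -/
def fullInput : VoronoiInput X where
  len := fun d => (len d : ℝ≥0∞)
  weight := weight
  sites := X.src '' X.faceDarts (X.face d₀)
  hole := X.face d₀

/-- The Voronoi diagram in `X'` of the green sites; artificial edges have infinite length. -/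
noncomputable def greenInput : VoronoiInput X' where
  len := Function.extend emb (fun d => (len d : ℝ≥0∞)) (fun _ => ⊤)
  weight := weight
  sites := greenSites X d₀ p
  hole := X'.face a

/-- The red site closest to `v` is closer to `v` than the green site closest to `v`. -/
def RedCloser (v : V) : Prop :=
  (⨅ r ∈ redSites X d₀ p q, (fullInput X len weight d₀).wdist r v) <
    ⨅ g ∈ greenSites X d₀ p, (fullInput X len weight d₀).wdist g v

/-- The nodes of the green dual Voronoi diagram that are deleted: the artificial ones (the leaf at
an artificial edge, and the faces of `X'` that are not faces of `X`) and those with a vertex that is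
closer to the red sites. -/
def deletedNodes : Set (greenInput X X' emb len weight d₀ p a).Node :=
  {n | match n with
    | .leaf d _ => d ∉ Set.range emb ∨ RedCloser X len weight d₀ p q (X'.src d) ∨
        RedCloser X len weight d₀ p q (X'.src (X'.rev d))
    | .tri f _ => (¬ ∃ f₀ : X.Face, X'.faceDarts f = emb '' X.faceDarts f₀) ∨
        ∃ d ∈ X'.faceDarts f, RedCloser X len weight d₀ p q (X'.src d)}

end Merge

/-! Colour each vertex of `X'` by the index in `0, …, p - 1` of its closest green site. Colour
classes are connected, the hole shows every colour once and in order, and all other faces are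
triangles; most of the argument concerns such colourings only.

The Jordan curve theorem enters as algebra. An edge `e` with end colours `i < k` closes to a
circuit: inside class `i` from the `i`-th site to `e`, across `e`, inside class `k` to the `k`-th
site, and back through the hole. Because the first homology of the sphere vanishes
(`exists_face_potential`, a rank count from Euler's formula), this circuit has a side function `Ψ`
(`IsSide`). It yields non-crossing of adjacent pairs of classes (`not_cross`) and, by a discrete
Stokes formula (`balance`), exactly one terminal dart in each direction between `i` and `k` whenever
the two classes are adjacent (`existsUnique_terminal`). So there is at most one Voronoi edge per
pair of colours. Its inner end, the dart `i → k`, lies on the hole or has its third colour strictly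
between `i` and `k`; its outer end is the dart `k → i`.

Survival respects this nesting. If an end of the edge `{i, k}` survives, the circuit can be drawn in
cells of the full diagram of `X`, so it meets neither red vertices nor artificial edges. All of
these lie on its outer side (`exists_side`), hence every trichromatic face with colours in `[i, k]`
survives (`IsSurvival.between`). A dangling edge therefore has a surviving inner end and a deleted
outer end.

Claim 1: a surviving component that contains the inner end of a dangling edge cannot leave the inner
side, all of whose nodes survive, so the only deleted node it can reach in one step is that outer
end.

Claim 2: by nesting, a colour has at most one dangling edge to greater and at most one to smaller
colours. Counting surviving terminal darts at colour `i`, plus for tails and minus for heads,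
triangles cancel and the hole telescopes; grouped by pairs of colours, Voronoi edges with two
surviving ends cancel. So the number of upward minus the number of downward dangling edges is `[i =
0] - [i = p - 1]`. -/

theorem Equiv.Perm.SameCycle.map_eq {α β : Type*} {σ : Equiv.Perm α} {f : α → β}
    (hf : ∀ x, f (σ x) = f x) {x y : α} (h : σ.SameCycle x y) : f x = f y := by
  obtain ⟨n, rfl⟩ := h
  induction n using Int.induction_on with
  | zero => simp
  | succ n ih => rw [add_comm, zpow_add, Equiv.Perm.mul_apply, zpow_one, hf, ih]
  | pred n ih =>
    rw [ih, ← hf ((σ ^ (-(n : ℤ) - 1)) x), ← Equiv.Perm.mul_apply, ← zpow_one_add]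
    congr 3
    ring

/-! ### Rotation systems -/

namespace PlaneMap

section Basic

variable {V D : Type*} (M : PlaneMap V D)

theorem src_rot (d : D) : M.src (M.rot d) = M.src d :=
  ((M.src_eq_iff d (M.rot d)).2 ⟨1, rfl⟩).symm

theorem src_rot_inv (d : D) : M.src (M.rot⁻¹ d) = M.src d := by
  rw [← M.src_rot]
  exact congrArg M.src (M.rot.apply_symm_apply d)

theorem next_apply (d : D) : M.next d = M.rot⁻¹ (M.rev d) := rfl

theorem next_rev (d : D) : M.next (M.rev d) = M.rot⁻¹ d := by rw [next_apply, M.rev_rev]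

theorem rot_next (d : D) : M.rot (M.next d) = M.rev d := by
  exact M.rot.apply_symm_apply (M.rev d)

theorem src_next (d : D) : M.src (M.next d) = M.src (M.rev d) := by
  rw [next_apply, src_rot_inv]

theorem face_eq_iff (d e : D) : M.face d = M.face e ↔ M.next.SameCycle d e :=
  Quotient.eq (r := Equiv.Perm.SameCycle.setoid M.next)

theorem face_next (d : D) : M.face (M.next d) = M.face d :=
  (M.face_eq_iff _ _).2 (Equiv.Perm.SameCycle.symm ⟨1, rfl⟩)

theorem face_surjective : Function.Surjective M.face := Quotient.mk_surjective

/-- A function on darts that is invariant under `rev` and under `next` is constant. -/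
theorem eq_of_invariant {α : Type*} {f : D → α} (hrev : ∀ d, f (M.rev d) = f d)
    (hnext : ∀ d, f (M.next d) = f d) (d e : D) : f d = f e := by
  have hrot : ∀ d, f (M.rot d) = f d := fun d => by
    have h := hnext (M.rev (M.rot d))
    rw [hrev, M.next_rev] at h
    exact h.symm.trans (congrArg f (M.rot.symm_apply_apply d))
  have hv : ∀ d e, M.src d = M.src e → f d = f e := fun d e h =>
    ((M.src_eq_iff d e).1 h).map_eq hrot
  have key : ∀ u v, Relation.ReflTransGen (fun x y => ∃ d, M.src d = x ∧ M.src (M.rev d) = y) u v →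
      ∀ d e, M.src d = u → M.src e = v → f d = f e := by
    intro u v h
    induction h with
    | refl => exact fun d e hd he => hv d e (hd.trans he.symm)
    | tail _ h ih =>
      obtain ⟨g, hg, hg'⟩ := h
      intro d e hd he
      rw [ih d g hd hg, ← hrev g]
      exact hv _ _ (hg'.trans he.symm)
  exact key _ _ (M.connected _ _) d e rfl rfl

end Basic

/-! ### Vanishing of the first homology of the sphere -/

section Homology

variable {V D : Type*} [Fintype D] (M : PlaneMap V D)

theorem exists_orientation : ∃ O : D → Prop, ∀ d, O (M.rev d) ↔ ¬ O d := by
  let r := Fintype.equivFin D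
  refine ⟨fun d => r d < r (M.rev d), fun d => ?_⟩
  have : r d ≠ r (M.rev d) := fun h => M.rev_ne d (r.injective h).symm
  simp only [M.rev_rev]
  omega

open Classical in
theorem sum_orientation {O : D → Prop} (hO : ∀ d, O (M.rev d) ↔ ¬ O d) (f : D → ℚ) :
    ∑ d : {d // O d}, (f d + f (M.rev d)) = ∑ d, f d := by
  rw [Finset.sum_add_distrib, ← Fintype.sum_subtype_add_sum_subtype O f]
  congr 1
  let s : {d // O d} ≃ {d // ¬ O d} :=
    { toFun := fun d => ⟨M.rev d, fun h => (hO _).1 h d.2⟩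
      invFun := fun d => ⟨M.rev d, (hO _).2 d.2⟩
      left_inv := fun d => Subtype.ext (M.rev_rev _)
      right_inv := fun d => Subtype.ext (M.rev_rev _) }
  exact Fintype.sum_equiv s _ _ fun d => rfl

open Classical in
/-- The first homology of the sphere vanishes: every circulation is the boundary of a function on
the faces. -/
theorem exists_face_potential [Fintype V] (P : D → ℚ) (hanti : ∀ d, P (M.rev d) = - P d)
    (hdiv : ∀ v, ∑ d with M.src d = v, P d = 0) :
    ∃ ψ : M.Face → ℚ, ∀ d, P d = ψ (M.face d) - ψ (M.face (M.rev d)) := by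
  rcases isEmpty_or_nonempty D with hD | ⟨⟨d₀⟩⟩
  · exact ⟨0, fun d => (hD.false d).elim⟩
  obtain ⟨O, hO⟩ := M.exists_orientation
  have : Finite M.Face := Quotient.finite _
  have : Fintype M.Face := Fintype.ofFinite _
  have hcard : Fintype.card D = 2 * Fintype.card {d // O d} := by
    have := M.sum_orientation hO (fun _ => 1)
    simp only [Finset.sum_const, Finset.card_univ] at this
    norm_num at this
    have h2 : ((Fintype.card {d // O d} * 2 : ℕ) : ℚ) = (Fintype.card D : ℕ) := by
      push_cast
      exact this
    have := Nat.cast_injective h2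
    omega
  have heuler : 2 * Fintype.card V + 2 * Fintype.card M.Face = Fintype.card D + 4 := by
    have := M.euler
    rw [Nat.card_eq_fintype_card, Nat.card_eq_fintype_card] at this
    rw [← Nat.card_eq_fintype_card (α := D), ← this, ← Nat.card_eq_fintype_card (α := M.Face),
      ← Nat.card_eq_fintype_card (α := Quotient (Equiv.Perm.SameCycle.setoid (M.rot⁻¹ * M.rev)))]
    rfl
  -- One row per edge, oriented by `O`: `A` is the vertex incidence matrix and `B` that of the dual
  -- graph. Both kernels consist of constants because the graph and its dual are connected.
  let A : Matrix {d // O d} V ℚ := fun d v =>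
    (if M.src d = v then 1 else 0) - (if M.src (M.rev d) = v then 1 else 0)
  let B : Matrix {d // O d} M.Face ℚ := fun d f =>
    (if M.face d = f then 1 else 0) - (if M.face (M.rev d) = f then 1 else 0)
  have hA : ∀ φ d, A.mulVec φ d = φ (M.src d) - φ (M.src (M.rev d)) := fun φ d => by
    simp [A, Matrix.mulVec, dotProduct, sub_mul, Finset.sum_sub_distrib]
  have hB : ∀ ψ d, B.mulVec ψ d = ψ (M.face d) - ψ (M.face (M.rev d)) := fun ψ d => by
    simp [B, Matrix.mulVec, dotProduct, sub_mul, Finset.sum_sub_distrib]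
  have hAT : ∀ (Q : D → ℚ), (∀ d, Q (M.rev d) = - Q d) → ∀ v,
      A.transpose.mulVec (fun d => Q d) v = ∑ d with M.src d = v, Q d := fun Q hQ v => by
    rw [Finset.sum_filter, ← M.sum_orientation hO]
    refine Finset.sum_congr rfl fun d _ => ?_
    change ((if M.src d = v then 1 else 0) - (if M.src (M.rev d) = v then 1 else 0)) * Q d = _
    rw [hQ]
    split_ifs <;> ring
  have hext : ∀ f : D → ℚ, (∀ d, f (M.rev d) = - f d) → (∀ d : {d // O d}, f d = 0) →
      ∀ d, f d = 0 := fun f hf h d => by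
    by_cases hd : O d
    · exact h ⟨d, hd⟩
    · have := h ⟨M.rev d, (hO d).2 hd⟩
      rw [hf] at this
      linarith
  have hkerA : Module.finrank ℚ (LinearMap.ker A.mulVecLin) ≤ 1 := by
    refine finrank_le_one ⟨fun _ => 1, ?_⟩ ?_
    · rw [LinearMap.mem_ker, Matrix.mulVecLin_apply]
      ext d
      rw [hA]
      simp
    · rintro ⟨φ, hφ⟩
      rw [LinearMap.mem_ker, Matrix.mulVecLin_apply] at hφ
      refine ⟨φ (M.src d₀), Subtype.ext ?_⟩
      ext v
      obtain ⟨d, rfl⟩ := M.src_surjective v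
      have h0 := hext (fun d => φ (M.src d) - φ (M.src (M.rev d)))
        (fun d => by rw [M.rev_rev]; ring) (fun d => by rw [← hA, hφ]; rfl)
      simp only [SetLike.mk_smul_mk, Pi.smul_apply, smul_eq_mul, mul_one]
      refine M.eq_of_invariant (f := fun d => φ (M.src d)) (fun d => ?_) (fun d => ?_) _ _
      · linarith [h0 d]
      · simp only [M.src_next]
        linarith [h0 d]
  have hkerB : Module.finrank ℚ (LinearMap.ker B.mulVecLin) ≤ 1 := by
    refine finrank_le_one ⟨fun _ => 1, ?_⟩ ?_
    · rw [LinearMap.mem_ker, Matrix.mulVecLin_apply]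
      ext d
      rw [hB]
      simp
    · rintro ⟨φ, hφ⟩
      rw [LinearMap.mem_ker, Matrix.mulVecLin_apply] at hφ
      refine ⟨φ (M.face d₀), Subtype.ext ?_⟩
      ext v
      obtain ⟨d, rfl⟩ := M.face_surjective v
      have h0 := hext (fun d => φ (M.face d) - φ (M.face (M.rev d)))
        (fun d => by rw [M.rev_rev]; ring) (fun d => by rw [← hB, hφ]; rfl)
      simp only [SetLike.mk_smul_mk, Pi.smul_apply, smul_eq_mul, mul_one]
      refine M.eq_of_invariant (f := fun d => φ (M.face d)) (fun d => ?_) (fun d => ?_) _ _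
      · linarith [h0 d]
      · simp only [M.face_next]
  have hle : LinearMap.range B.mulVecLin ≤ LinearMap.ker A.transpose.mulVecLin := by
    rintro _ ⟨ψ, rfl⟩
    rw [LinearMap.mem_ker]
    simp only [Matrix.mulVecLin_apply]
    have : B.mulVec ψ = fun d : {d // O d} => ψ (M.face d) - ψ (M.face (M.rev d)) := by
      ext d
      exact hB _ _
    rw [this]
    ext v
    rw [hAT (fun d => ψ (M.face d) - ψ (M.face (M.rev d))) (fun d => by rw [M.rev_rev]; ring)]
    -- The face on the right of a dart is the face on the left of its predecessor in the rotation,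
    -- so the differences around a vertex cancel.
    rw [Finset.sum_sub_distrib, Pi.zero_apply, sub_eq_zero, Finset.sum_filter, Finset.sum_filter,
      ← Equiv.sum_comp M.rot⁻¹]
    refine Finset.sum_congr rfl fun d _ => ?_
    rw [M.src_rot_inv, ← M.next_rev, M.face_next]
  have h1 := A.mulVecLin.finrank_range_add_finrank_ker
  have h2 := B.mulVecLin.finrank_range_add_finrank_ker
  have h3 := A.transpose.mulVecLin.finrank_range_add_finrank_ker
  have h4 : Module.finrank ℚ (LinearMap.range A.transpose.mulVecLin) =
      Module.finrank ℚ (LinearMap.range A.mulVecLin) := A.rank_transpose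
  simp only [Module.finrank_fintype_fun_eq_card] at h1 h2 h3
  -- With `E` edges and `F` faces, `dim ker Aᵀ = E - rank A ≤ E - |V| + 1 = F - 1 ≤ rank B`, where
  -- the middle equality is Euler's formula.
  have heq := Submodule.eq_of_le_of_finrank_le hle (by omega)
  have hP : (fun d : {d // O d} => P d) ∈ LinearMap.ker A.transpose.mulVecLin := by
    rw [LinearMap.mem_ker, Matrix.mulVecLin_apply]
    ext v
    rw [hAT P hanti, hdiv]
    rfl
  rw [← heq] at hP
  obtain ⟨ψ, hψ⟩ := hP
  refine ⟨ψ, fun d => sub_eq_zero.1 ?_⟩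
  refine hext (fun d => P d - (ψ (M.face d) - ψ (M.face (M.rev d)))) (fun d => ?_) (fun d => ?_) d
  · rw [hanti, M.rev_rev]
    ring
  · rw [← hB, ← Matrix.mulVecLin_apply, hψ]
    exact sub_self _

end Homology

end PlaneMap

namespace PlaneMap

/-! ### Faces as orbits of `next` -/

section Cycles

variable {V D : Type*} (M : PlaneMap V D)

theorem face_iterate (d : D) (m : ℕ) : M.face (M.next^[m] d) = M.face d := by
  induction m with
  | zero => rfl
  | succ m ih => rw [Function.iterate_succ_apply', face_next, ih]

variable [Finite D]

theorem minimalPeriod_next_pos (d : D) : 0 < Function.minimalPeriod M.next d := by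
  refine Function.IsPeriodicPt.minimalPeriod_pos (orderOf_pos M.next) ?_
  change M.next^[orderOf M.next] d = d
  rw [← Equiv.Perm.coe_pow, pow_orderOf_eq_one]
  rfl

theorem face_eq_iff_iterate (d e : D) :
    M.face e = M.face d ↔ ∃ m < Function.minimalPeriod M.next d, M.next^[m] d = e := by
  constructor
  · intro h
    obtain ⟨n, -, hn⟩ := ((M.face_eq_iff _ _).1 h.symm).exists_pow_eq'
    refine ⟨n % Function.minimalPeriod M.next d, Nat.mod_lt _ (M.minimalPeriod_next_pos d), ?_⟩
    rw [Function.iterate_mod_minimalPeriod_eq, ← hn, Equiv.Perm.coe_pow]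
  · rintro ⟨m, -, rfl⟩
    exact M.face_iterate d m

theorem ncard_faceDarts (d : D) :
    (M.faceDarts (M.face d)).ncard = Function.minimalPeriod M.next d := by
  have : M.faceDarts (M.face d) =
      (fun m => M.next^[m] d) '' Set.Iio (Function.minimalPeriod M.next d) := by
    ext e
    exact M.face_eq_iff_iterate d e
  rw [this, Set.InjOn.ncard_image Function.iterate_injOn_Iio_minimalPeriod,
    Set.ncard_eq_toFinset_card']
  simp

theorem IsTriangle.next_next_next {M : PlaneMap V D} {d : D} (h : M.IsTriangle (M.face d)) :
    M.next (M.next (M.next d)) = d := by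
  have := Function.iterate_minimalPeriod (f := M.next) (x := d)
  rwa [← ncard_faceDarts, show (M.faceDarts (M.face d)).ncard = 3 from h] at this

theorem IsTriangle.face_eq {M : PlaneMap V D} {d e : D} (h : M.IsTriangle (M.face d))
    (he : M.face e = M.face d) : e = d ∨ e = M.next d ∨ e = M.next (M.next d) := by
  obtain ⟨m, hm, rfl⟩ := (M.face_eq_iff_iterate d e).1 he
  rw [← ncard_faceDarts, show (M.faceDarts (M.face d)).ncard = 3 from h] at hm
  interval_cases m <;> simp

theorem IsTriangle.next_ne {M : PlaneMap V D} {d : D} (h : M.IsTriangle (M.face d)) :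
    M.next d ≠ d := by
  intro hd
  have h1 : Function.minimalPeriod M.next d ≤ 1 :=
    Function.IsPeriodicPt.minimalPeriod_le one_pos hd
  rw [← ncard_faceDarts, show (M.faceDarts (M.face d)).ncard = 3 from h] at h1
  omega

end Cycles

/-! ### Unit flows and side functions -/

section Flow

variable {V D : Type*} (M : PlaneMap V D)

/-- There is a dart in `S` from `x` to `y`. -/
def Step (S : D → Prop) (x y : V) : Prop := ∃ d, S d ∧ M.src d = x ∧ M.src (M.rev d) = y

variable {M}

theorem Step.mono {S T : D → Prop} (h : ∀ d, S d → T d) {u v : V}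
    (huv : Relation.ReflTransGen (M.Step S) u v) : Relation.ReflTransGen (M.Step T) u v :=
  Relation.ReflTransGen.mono (fun _ _ ⟨d, hd, hd'⟩ => ⟨d, h d hd, hd'⟩) _ _ huv

theorem Step.symm {S : D → Prop} (h : ∀ d, S d → S (M.rev d)) {u v : V}
    (huv : Relation.ReflTransGen (M.Step S) u v) : Relation.ReflTransGen (M.Step S) v u := by
  have : Std.Symm (M.Step S) := ⟨fun x y ⟨d, hd, hx, hy⟩ =>
    ⟨M.rev d, h d hd, hy, by rw [M.rev_rev, hx]⟩⟩
  exact (Relation.ReflTransGen.stdSymm (r := M.Step S)).symm _ _ huv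

variable [Fintype D] (M)

open Classical in
theorem exists_flow_dart (e : D) : ∃ P : D → ℚ, (∀ d, P (M.rev d) = - P d) ∧
    (∀ w, ∑ d with M.src d = w, P d =
      (if M.src e = w then 1 else 0) - (if M.src (M.rev e) = w then 1 else 0)) ∧
    P e = 1 ∧ ∀ d, d ≠ e → d ≠ M.rev e → P d = 0 := by
  refine ⟨fun d => (if d = e then 1 else 0) - (if d = M.rev e then 1 else 0), ?_, ?_, ?_, ?_⟩
  · intro d
    have h1 : M.rev d = e ↔ d = M.rev e :=
      ⟨fun h => by rw [← h, M.rev_rev], fun h => by rw [h, M.rev_rev]⟩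
    have h2 : M.rev d = M.rev e ↔ d = e := M.rev.injective.eq_iff
    simp only [h1, h2]
    ring
  · intro w
    simp [Finset.sum_sub_distrib]
  · simp [(M.rev_ne e).symm]
  · intro d h1 h2
    simp [h1, h2]

open Classical in
theorem exists_flow {S : D → Prop} (hS : ∀ d, S d → S (M.rev d)) {u v : V}
    (h : Relation.ReflTransGen (M.Step S) u v) : ∃ P : D → ℚ, (∀ d, P (M.rev d) = - P d) ∧
    (∀ w, ∑ d with M.src d = w, P d = (if u = w then 1 else 0) - (if v = w then 1 else 0)) ∧
    ∀ d, ¬ S d → P d = 0 := by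
  induction h with
  | refl => exact ⟨0, by simp, by simp, by simp⟩
  | tail _ h ih =>
    obtain ⟨e, he, rfl, rfl⟩ := h
    obtain ⟨P, h1, h2, h3⟩ := ih
    obtain ⟨Q, k1, k2, -, k3⟩ := M.exists_flow_dart e
    refine ⟨P + Q, fun d => ?_, fun w => ?_, fun d hd => ?_⟩
    · simp only [Pi.add_apply, h1, k1]
      ring
    · simp only [Pi.add_apply, Finset.sum_add_distrib, h2, k2]
      ring
    · rw [Pi.add_apply, h3 d hd, k3 d (fun h => hd (h ▸ he)) (fun h => hd (h ▸ hS e he)), add_zero]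

/-- A function on darts that jumps only across the darts in `S` and by one across `e`, is constant
on the faces other than that of `b`, and on the latter is the indicator of the boundary arc
from the `i`-th to the `k`-th vertex. -/
structure IsSide (b : D) (p i k : ℕ) (S : D → Prop) (e : D) (Ψ : D → ℚ) : Prop where
  cross : Ψ e = Ψ (M.rev e) + 1
  same : ∀ d, ¬ S d → d ≠ e → d ≠ M.rev e → Ψ d = Ψ (M.rev d)
  next : ∀ d, M.face d ≠ M.face b → Ψ (M.next d) = Ψ d
  hole : ∀ m < p, Ψ (M.next^[m] b) = if i ≤ m ∧ m < k then 1 else 0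

-- The flow from the `i`-th boundary vertex through `e` to the `k`-th one, minus the boundary arc
-- between them, is a circulation and hence has a face potential `ψ`. Adding the arc's indicator `β`
-- to `ψ` moves the closing arc into the interior of the hole: the jumps across edges then come from
-- the flow alone, and the hole is cut in two.
open Classical in
theorem exists_isSide [Finite V] {b : D} {p i k : ℕ} {S : D → Prop} {e : D} (hik : i ≤ k)
    (hinj : Set.InjOn (fun m => M.next^[m] b) (Set.Iio p)) (hkp : k ≤ p)
    (hS : ∀ d, S d → S (M.rev d)) (he : ¬ S e)
    (h1 : Relation.ReflTransGen (M.Step S) (M.bdry b i) (M.src e))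
    (h2 : Relation.ReflTransGen (M.Step S) (M.src (M.rev e)) (M.bdry b k)) :
    ∃ Ψ, M.IsSide b p i k S e Ψ := by
  have := Fintype.ofFinite V
  obtain ⟨P₁, a1, a2, a3⟩ := M.exists_flow hS h1
  obtain ⟨P₂, b1, b2, b3⟩ := M.exists_flow hS h2
  obtain ⟨P₃, c1, c2, c3, c4⟩ := M.exists_flow_dart e
  let β : D → ℚ := fun d => ∑ m ∈ Finset.Ico i k, if d = M.next^[m] b then 1 else 0
  have hβ1 : ∀ w, ∑ d with M.src d = w, β d =
      ∑ m ∈ Finset.Ico i k, if M.bdry b m = w then 1 else 0 := fun w => by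
    rw [Finset.sum_comm]
    refine Finset.sum_congr rfl fun m _ => ?_
    rw [Finset.sum_filter, Finset.sum_eq_single (M.next^[m] b)]
    · rw [if_pos rfl]
      rfl
    · intro d _ hd
      simp [hd]
    · simp
  have hβ2 : ∀ w, ∑ d with M.src d = w, β (M.rev d) =
      ∑ m ∈ Finset.Ico i k, if M.bdry b (m + 1) = w then 1 else 0 := fun w => by
    rw [Finset.sum_comm]
    refine Finset.sum_congr rfl fun m _ => ?_
    rw [Finset.sum_filter, Finset.sum_eq_single (M.rev (M.next^[m] b))]
    · rw [M.rev_rev, if_pos rfl, bdry, Function.iterate_succ_apply', M.src_next]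
    · intro d _ hd
      have : M.rev d ≠ M.next^[m] b := fun h => hd (by rw [← h, M.rev_rev])
      simp [this]
    · simp
  -- The divergence of the boundary arc telescopes to its two ends.
  have hβ3 : ∀ w, (∑ d with M.src d = w, β d) - ∑ d with M.src d = w, β (M.rev d) =
      (if M.bdry b i = w then 1 else 0) - (if M.bdry b k = w then 1 else 0) := fun w => by
    rw [hβ1, hβ2, ← Finset.sum_sub_distrib]
    have := Finset.sum_Ico_sub (fun m => if M.bdry b m = w then (1 : ℚ) else 0) hik
    rw [← neg_sub, ← this, ← Finset.sum_neg_distrib]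
    simp only [neg_sub]
  have hβ4 : ∀ d, M.face d ≠ M.face b → β d = 0 := fun d hd => by
    refine Finset.sum_eq_zero fun m _ => if_neg ?_
    rintro rfl
    exact hd (M.face_iterate b m)
  have hβ5 : ∀ m < p, β (M.next^[m] b) = if i ≤ m ∧ m < k then 1 else 0 := fun m hm => by
    have : ∀ l ∈ Finset.Ico i k, (if M.next^[m] b = M.next^[l] b then (1 : ℚ) else 0) =
        if m = l then 1 else 0 := fun l hl => by
      rw [Finset.mem_Ico] at hl
      have : M.next^[m] b = M.next^[l] b ↔ m = l :=
        ⟨fun h => hinj hm (hl.2.trans_le hkp) h, fun h => by rw [h]⟩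
      simp only [this]
    change (∑ l ∈ Finset.Ico i k, if M.next^[m] b = M.next^[l] b then (1 : ℚ) else 0) = _
    rw [Finset.sum_congr rfl this, Finset.sum_ite_eq]
    simp [Finset.mem_Ico]
  obtain ⟨ψ, hψ⟩ := M.exists_face_potential
    (fun d => P₁ d + P₃ d + P₂ d - β d + β (M.rev d))
    (fun d => by rw [a1, b1, c1, M.rev_rev]; ring)
    (fun w => by
      simp only [Finset.sum_add_distrib, Finset.sum_sub_distrib, a2, b2, c2]
      linarith [hβ3 w])
  -- The constant normalises the side function to equal `β` on the hole.
  refine ⟨fun d => ψ (M.face d) + β d - ψ (M.face b), ?_, ?_, ?_, ?_⟩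
  · have := hψ e
    rw [a3 e he, b3 e he, c3] at this
    linarith
  · intro d h h' h''
    have := hψ d
    rw [a3 d h, b3 d h, c4 d h' h''] at this
    linarith
  · intro d hd
    simp only [face_next, hβ4 d hd, hβ4 (M.next d) (by rwa [face_next])]
  · intro m hm
    simp only [face_iterate, hβ5 m hm]
    ring

end Flow

end PlaneMap

/-! ### Connected colourings around a hole -/

namespace PlaneMap

variable {V D : Type*}

/-- A colouring of the vertices by `0, …, p - 1` with connected colour classes, in which the `p`
vertices of the face of `b` have the colours `0, …, p - 1` in this order, all other faces being
triangles. -/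
structure IsHoleColoring (M : PlaneMap V D) (b : D) (p : ℕ) (c : V → ℕ) : Prop where
  two_le : 2 ≤ p
  period : M.next^[p] b = b
  color_lt : ∀ v, c v < p
  color_bdry : ∀ m < p, c (M.bdry b m) = m
  triangle : ∀ f, f ≠ M.face b → M.IsTriangle f
  connected : ∀ v, Relation.ReflTransGen
    (M.Step fun d => c (M.src d) = c v ∧ c (M.src (M.rev d)) = c v) (M.bdry b (c v)) v

/-- The dart `d` is on the face of `b`, or the three vertices of its face have three colours. -/
def Terminal (M : PlaneMap V D) (b : D) (c : V → ℕ) (d : D) : Prop :=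
  M.face d = M.face b ∨ (c (M.src d) ≠ c (M.src (M.next d)) ∧
    c (M.src (M.next d)) ≠ c (M.src (M.next (M.next d))) ∧
    c (M.src d) ≠ c (M.src (M.next (M.next d))))

/-- Sets of darts that, with a dart, contain its reverse and all darts with ends of different
colours on its face, unless the dart is terminal. -/
structure LinkClosed (M : PlaneMap V D) (b : D) (c : V → ℕ) (K : D → Prop) : Prop where
  rev : ∀ d, K d → K (M.rev d)
  face : ∀ d e, ¬ M.Terminal b c d → M.face d = M.face e → c (M.src d) ≠ c (M.src (M.rev d)) →
    c (M.src e) ≠ c (M.src (M.rev e)) → K d → K e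

variable {M : PlaneMap V D} {b : D} {p : ℕ} {c : V → ℕ}

namespace IsHoleColoring

theorem injOn (h : M.IsHoleColoring b p c) :
    Set.InjOn (fun m => M.next^[m] b) (Set.Iio p) := fun m hm l hl hml => by
  rw [← h.color_bdry m hm, ← h.color_bdry l hl]
  exact congrArg (fun d => c (M.src d)) hml

theorem face_eq_iff [Finite D] (h : M.IsHoleColoring b p c) (d : D) :
    M.face d = M.face b ↔ ∃ m < p, M.next^[m] b = d := by
  constructor
  · intro hd
    obtain ⟨m, hm, rfl⟩ := (M.face_eq_iff_iterate b d).1 hd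
    have hp := h.two_le
    exact ⟨m, hm.trans_le (Function.IsPeriodicPt.minimalPeriod_le (by omega) h.period), rfl⟩
  · rintro ⟨m, -, rfl⟩
    exact M.face_iterate b m

theorem color_iterate (h : M.IsHoleColoring b p c) {m : ℕ} (hm : m < p) :
    c (M.src (M.next^[m] b)) = m := h.color_bdry m hm

theorem color_rev_iterate (h : M.IsHoleColoring b p c) {m : ℕ} (hm : m + 1 < p) :
    c (M.src (M.rev (M.next^[m] b))) = m + 1 := by
  rw [← M.src_next, ← Function.iterate_succ_apply' M.next]
  exact h.color_bdry (m + 1) hm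

theorem color_rev_last (h : M.IsHoleColoring b p c) :
    c (M.src (M.rev (M.next^[p - 1] b))) = 0 := by
  have hp := h.two_le
  rw [← M.src_next, ← Function.iterate_succ_apply' M.next, show (p - 1).succ = p by omega, h.period]
  exact h.color_bdry 0 (by omega)

theorem terminal_next [Finite D] (h : M.IsHoleColoring b p c) (d : D) :
    M.Terminal b c (M.next d) ↔ M.Terminal b c d := by
  unfold Terminal
  by_cases hd : M.face d = M.face b
  · simp [face_next, hd]
  · rw [face_next, (h.triangle _ hd).next_next_next]
    grind

end IsHoleColoring

section Side

variable {i k : ℕ} {S : D → Prop} {e : D} {Ψ : D → ℚ}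

/-- Along a face, a side function can change only where the closing arc enters or leaves the hole,
at the `i`-th and the `k`-th boundary vertex. -/
theorem IsSide.next_eq [Fintype D] (hΨ : M.IsSide b p i k S e Ψ) (h : M.IsHoleColoring b p c)
    (hik : i < k) (hkp : k < p) {y : D} (h1 : M.src (M.next y) ≠ M.bdry b i)
    (h2 : M.src (M.next y) ≠ M.bdry b k) : Ψ (M.next y) = Ψ y := by
  by_cases hy : M.face y = M.face b
  · obtain ⟨m, hm, rfl⟩ := (h.face_eq_iff y).1 hy
    rw [← Function.iterate_succ_apply' M.next] at h1 h2 ⊢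
    have h1' : m + 1 ≠ i := fun hi => h1 (by rw [← hi]; rfl)
    have h2' : m + 1 ≠ k := fun hi => h2 (by rw [← hi]; rfl)
    rw [hΨ.hole m hm]
    rcases Nat.lt_or_ge (m + 1) p with hm' | hm'
    · rw [hΨ.hole _ hm']
      refine if_congr ?_ rfl rfl
      omega
    -- The boundary walk wraps around to vertex `0`. Since `k < p`, the last dart has value `0`, and
    -- so has dart `0` because `i ≠ 0`.
    · have hmp : m + 1 = p := by omega
      have hi : i ≠ 0 := fun hi => by
        rw [show m.succ = p from hmp, h.period, hi] at h1
        exact h1 rfl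
      have h0 := hΨ.hole 0 (by omega)
      rw [Function.iterate_zero, id_eq] at h0
      rw [show m.succ = p from hmp, h.period, h0]
      refine if_congr ?_ rfl rfl
      omega
  · exact hΨ.next y hy

/-- Turning around a vertex off the circuit alternates between crossing an edge, where `Ψ` does not
jump by `hT'`, and following a face corner. Here `T` stands for a set of vertices that the circuit
avoids. -/
theorem IsSide.eq_of_src_eq [Fintype D] (hΨ : M.IsSide b p i k S e Ψ)
    (h : M.IsHoleColoring b p c) (hik : i < k) (hkp : k < p) {T : V → Prop}
    (hT : ∀ v, T v → v ≠ M.bdry b i ∧ v ≠ M.bdry b k)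
    (hT' : ∀ d, T (M.src d) → Ψ d = Ψ (M.rev d)) {x y : D} (hx : T (M.src x))
    (hxy : M.src x = M.src y) : Ψ x = Ψ y := by
  classical
  have := ((M.src_eq_iff x y).1 hxy).map_eq (f := fun d => if T (M.src d) then Ψ d else 0)
    (fun d => by
      rw [M.src_rot]
      refine ite_congr rfl (fun hd => ?_) (fun _ => rfl)
      have hn : M.next (M.rev (M.rot d)) = d := by
        rw [M.next_rev]
        exact M.rot.symm_apply_apply d
      rw [hT' _ (by rwa [M.src_rot]), ← hΨ.next_eq h hik hkp, hn]
      · rw [hn]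
        exact (hT _ hd).1
      · rw [hn]
        exact (hT _ hd).2)
  rwa [if_pos hx, if_pos (hxy ▸ hx)] at this

theorem IsSide.eq_of_walk [Fintype D] (hΨ : M.IsSide b p i k S e Ψ)
    (h : M.IsHoleColoring b p c) (hik : i < k) (hkp : k < p) {T : V → Prop}
    (hT : ∀ v, T v → v ≠ M.bdry b i ∧ v ≠ M.bdry b k)
    (hT' : ∀ d, T (M.src d) → Ψ d = Ψ (M.rev d)) {u v : V}
    (huv : Relation.ReflTransGen (M.Step fun d => T (M.src d) ∧ T (M.src (M.rev d))) u v)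
    (hu : T u) {x y : D} (hx : M.src x = u) (hy : M.src y = v) : Ψ x = Ψ y := by
  induction huv generalizing y with
  | refl => exact hΨ.eq_of_src_eq h hik hkp hT hT' (hx ▸ hu) (hx.trans hy.symm)
  | tail _ hs ih =>
    obtain ⟨d, ⟨hd, hd'⟩, hd1, hd2⟩ := hs
    rw [ih hd1, hT' d hd]
    exact hΨ.eq_of_src_eq h hik hkp hT hT' hd' (hd2.trans hy.symm)

/-- A colour class other than `i` and `k` is connected and disjoint from the circuit, so it lies
entirely on the side of its own site, which is read off from the hole. -/
theorem IsSide.eq_of_color [Fintype D] (hΨ : M.IsSide b p i k S e Ψ)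
    (h : M.IsHoleColoring b p c) (hik : i < k) (hkp : k < p)
    (hS : ∀ d, S d → c (M.src d) = i ∨ c (M.src d) = k) (he : c (M.src e) = i)
    (he' : c (M.src (M.rev e)) = k) {d : D} (hi : c (M.src d) ≠ i) (hk : c (M.src d) ≠ k) :
    Ψ d = if i < c (M.src d) ∧ c (M.src d) < k then 1 else 0 := by
  have hlt := h.color_lt (M.src d)
  rw [← hΨ.eq_of_walk h hik hkp (T := fun v => c v = c (M.src d)) (x := M.next^[c (M.src d)] b)
    ?_ ?_ (h.connected _) (h.color_bdry _ hlt) rfl rfl, hΨ.hole _ hlt]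
  · refine if_congr ?_ rfl rfl
    omega
  · refine fun v hv => ⟨?_, ?_⟩
    · rintro rfl
      rw [h.color_bdry _ (by omega)] at hv
      omega
    · rintro rfl
      rw [h.color_bdry _ (by omega)] at hv
      omega
  · refine fun x hx => hΨ.same x (fun hxS => ?_) ?_ ?_
    · have := hS x hxS
      omega
    · rintro rfl
      omega
    · rintro rfl
      omega

end Side

namespace IsHoleColoring

variable [Fintype D]

/-- Darts with both ends of colour `i`, or both of colour `k`. -/
abbrev MonoDart (M : PlaneMap V D) (c : V → ℕ) (i k : ℕ) (d : D) : Prop :=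
  c (M.src d) = c (M.src (M.rev d)) ∧ (c (M.src d) = i ∨ c (M.src d) = k)

theorem exists_isSide [Finite V] (h : M.IsHoleColoring b p c) {i k : ℕ} (hik : i < k) {e : D}
    (he : c (M.src e) = i) (he' : c (M.src (M.rev e)) = k) :
    ∃ Ψ, M.IsSide b p i k (MonoDart M c i k) e Ψ := by
  have hkp : k < p := he' ▸ h.color_lt _
  have hS : ∀ d, MonoDart M c i k d → MonoDart M c i k (M.rev d) := by
    intro d hd
    simp only [MonoDart, M.rev_rev] at hd ⊢
    omega
  refine M.exists_isSide hik.le h.injOn hkp.le hS (fun hS => ?_) ?_ ?_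
  · have := hS.1
    omega
  · subst he
    exact Step.mono (fun d hd => ⟨hd.1.trans hd.2.symm, Or.inl hd.1⟩) (h.connected _)
  · subst he'
    exact Step.symm hS (Step.mono (fun d hd => ⟨hd.1.trans hd.2.symm, Or.inr hd.1⟩) (h.connected _))

/-- Two pairs of adjacent colour classes do not cross. -/
theorem not_cross [Finite V] (h : M.IsHoleColoring b p c) {e d : D}
    (hik : c (M.src e) < c (M.src (M.rev e)))
    (h1 : c (M.src d) ≠ c (M.src e)) (h2 : c (M.src d) ≠ c (M.src (M.rev e)))
    (h3 : c (M.src (M.rev d)) ≠ c (M.src e)) (h4 : c (M.src (M.rev d)) ≠ c (M.src (M.rev e))) :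
    (c (M.src e) < c (M.src d) ∧ c (M.src d) < c (M.src (M.rev e))) ↔
      (c (M.src e) < c (M.src (M.rev d)) ∧ c (M.src (M.rev d)) < c (M.src (M.rev e))) := by
  obtain ⟨Ψ, hΨ⟩ := h.exists_isSide hik rfl rfl
  have hkp := h.color_lt (M.src (M.rev e))
  have k1 := hΨ.eq_of_color h hik hkp (fun d hd => hd.2) rfl rfl h1 h2
  have k2 := hΨ.eq_of_color h hik hkp (fun d hd => hd.2) rfl rfl h3 h4
  rw [hΨ.same d (fun hd => by have := hd.2; omega) (by rintro rfl; omega) (by rintro rfl; omega),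
    k2] at k1
  split_ifs at k1 <;> first | omega | exact absurd k1 (by norm_num)

/-- Summation by triangles without choosing representatives: `u` is constant on faces, so shifting
`f` along `next` leaves the sum unchanged, and three times the sum is a sum of vanishing triangle
sums. -/
theorem sum_eq_zero {u f : D → ℚ}
    (hu : ∀ d, M.face d ≠ M.face b → u (M.next d) = u d) (h0 : ∀ d, M.face d = M.face b → u d = 0)
    (hf : ∀ d, M.face d ≠ M.face b → u d ≠ 0 → f d + f (M.next d) + f (M.next (M.next d)) = 0) :
    ∑ d, u d * f d = 0 := by
  have h1 : ∀ d, u (M.next d) = u d := fun d => by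
    by_cases hd : M.face d = M.face b
    · rw [h0 d hd, h0 _ (by rwa [face_next])]
    · exact hu d hd
  have h2 : ∑ d, u d * f (M.next d) = ∑ d, u d * f d := by
    rw [← Equiv.sum_comp M.next (fun d => u d * f d)]
    simp only [h1]
  have h3 : ∑ d, u d * f (M.next (M.next d)) = ∑ d, u d * f d := by
    rw [← h2, ← Equiv.sum_comp M.next (fun d => u d * f (M.next d))]
    simp only [h1]
  have h4 : ∑ d, u d * (f d + f (M.next d) + f (M.next (M.next d))) = 0 :=
    Finset.sum_eq_zero fun d _ => by
      by_cases hd : u d = 0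
      · rw [hd, zero_mul]
      · rw [hf d (fun hd' => hd (h0 d hd')) hd, mul_zero]
  simp only [mul_add, Finset.sum_add_distrib, h2, h3] at h4
  linarith

open Classical in
/-- Indicator of the darts in `K` from colour `i` to colour `k`. -/
noncomputable def dir (M : PlaneMap V D) (c : V → ℕ) (K : D → Prop) (i k : ℕ) (d : D) : ℚ :=
  if K d ∧ c (M.src d) = i ∧ c (M.src (M.rev d)) = k then 1 else 0

-- A discrete Stokes formula. In a triangle that is not terminal, darts of `K` between the colours
-- `i` and `k` occur either not at all or as a pair in opposite directions, so their contributions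
-- cancel and only terminal darts remain.
open Classical in
theorem balance (h : M.IsHoleColoring b p c) {i k : ℕ} (hik : i ≠ k) {K : D → Prop}
    (hK : M.LinkClosed b c K) {g : D → ℚ} (hg : ∀ d, M.face d ≠ M.face b → g (M.next d) = g d) :
    ∑ d, dir M c K i k d * (g d - g (M.rev d)) =
      ∑ d with M.Terminal b c d, g d * (dir M c K i k d - dir M c K i k (M.rev d)) := by
  have h1 : ∑ d, dir M c K i k d * (g d - g (M.rev d)) =
      ∑ d, g d * (dir M c K i k d - dir M c K i k (M.rev d)) := by
    simp only [mul_sub, Finset.sum_sub_distrib]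
    congr 1
    · exact Finset.sum_congr rfl fun d _ => mul_comm _ _
    · rw [← Equiv.sum_comp M.rev]
      exact Finset.sum_congr rfl fun d _ => by rw [M.rev_rev, mul_comm]
  have h2 : ∑ d, (if M.Terminal b c d then 0 else g d) *
      (dir M c K i k d - dir M c K i k (M.rev d)) = 0 := by
    refine sum_eq_zero (b := b) (fun d hd => ?_) (fun d hd => if_pos (Or.inl hd)) (fun d hd hd' => ?_)
    · rw [hg d hd]
      exact if_congr (h.terminal_next d) rfl rfl
    · have ht : ¬ M.Terminal b c d := fun ht => hd' (if_pos ht)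
      have ht1 : ¬ M.Terminal b c (M.next d) := fun h' => ht ((h.terminal_next d).1 h')
      have ht2 : ¬ M.Terminal b c (M.next (M.next d)) := fun h' => ht1 ((h.terminal_next _).1 h')
      have k1 := hK.face d (M.next d) ht (M.face_next d).symm
      have k2 := hK.face (M.next d) d ht1 (M.face_next d)
      have k3 := hK.face _ (M.next (M.next d)) ht1 (M.face_next _).symm
      have k4 := hK.face _ (M.next d) ht2 (M.face_next _)
      have k5 := hK.face d (M.next (M.next d)) ht (by rw [face_next, face_next])
      have k6 := hK.face _ d ht2 (by rw [face_next, face_next])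
      have r : ∀ d, K (M.rev d) ↔ K d := fun d =>
        ⟨fun hd => by rw [← M.rev_rev d]; exact hK.rev _ hd, hK.rev d⟩
      have e3 := M.src_next (M.next (M.next d))
      rw [(h.triangle _ hd).next_next_next] at e3
      simp only [Terminal, hd, false_or] at ht
      simp only [dir, r, M.rev_rev]
      simp only [← M.src_next] at k1 k2 k3 k4 k5 k6 e3 ⊢
      simp only [(h.triangle _ hd).next_next_next] at k3 k4 k5 k6 ⊢
      clear e3 ht1 ht2 r hd' h1 hg hK
      generalize c (M.src d) = x at *
      generalize c (M.src (M.next d)) = y at *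
      generalize c (M.src (M.next (M.next d))) = z at *
      generalize K d = A at *
      generalize K (M.next d) = B at *
      generalize K (M.next (M.next d)) = C at *
      clear hd h
      -- A triangle that is not terminal repeats a colour. If exactly two colours occur, exactly two
      -- of its darts are bichromatic, and `LinkClosed` puts both or neither into `K`.
      by_cases hxy : x = y
      · subst hxy
        by_cases hyz : x = z
        · subst hyz
          split_ifs <;> simp_all
        · have : B ↔ C := ⟨k3 hyz (Ne.symm hyz), k4 (Ne.symm hyz) hyz⟩
          split_ifs <;> simp_all
      · by_cases hyz : y = z
        · subst hyz
          have : A ↔ C := ⟨k5 hxy (Ne.symm hxy), k6 (Ne.symm hxy) hxy⟩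
          split_ifs <;> simp_all
        · have hxz : x = z := by tauto
          subst hxz
          have : A ↔ B := ⟨k1 hxy hyz, k2 hyz hxy⟩
          split_ifs <;> simp_all
  refine h1.trans (Eq.trans ?_ (add_zero _))
  rw [← h2, Finset.sum_filter, ← Finset.sum_add_distrib]
  refine Finset.sum_congr rfl fun d _ => ?_
  split_ifs <;> ring

end IsHoleColoring

end PlaneMap

/-! ### The two ends of a Voronoi edge -/

namespace PlaneMap

variable {V D : Type*} {M : PlaneMap V D} {b : D} {p : ℕ} {c : V → ℕ}

namespace IsHoleColoring

theorem third_ne {d : D} (ht : M.Terminal b c d) (hd : M.face d ≠ M.face b) :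
    c (M.src (M.next (M.next d))) ≠ c (M.src d) ∧
      c (M.src (M.next (M.next d))) ≠ c (M.src (M.rev d)) := by
  obtain ⟨-, h2, h3⟩ := ht.resolve_left hd
  exact ⟨h3.symm, by rw [← M.src_next]; exact h2.symm⟩

variable [Fintype D]

section Side

variable {i k : ℕ} {S : D → Prop} {e : D} {Ψ : D → ℚ}

theorem _root_.PlaneMap.IsSide.eq_of_third (hΨ : M.IsSide b p i k S e Ψ)
    (h : M.IsHoleColoring b p c) (hik : i < k) (hkp : k < p)
    (hS : ∀ d, S d → c (M.src d) = i ∨ c (M.src d) = k) (he : c (M.src e) = i)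
    (he' : c (M.src (M.rev e)) = k) {d : D} (hd : M.face d ≠ M.face b)
    (h1 : c (M.src (M.next (M.next d))) ≠ i) (h2 : c (M.src (M.next (M.next d))) ≠ k) :
    Ψ d = if i < c (M.src (M.next (M.next d))) ∧ c (M.src (M.next (M.next d))) < k
      then 1 else 0 := by
  rw [← hΨ.eq_of_color h hik hkp hS he he' h1 h2, hΨ.next _ (by rwa [face_next]), hΨ.next d hd]

/-- The value of a side function at a terminal dart between the colours `i` and `k`. -/
theorem side_terminal (h : M.IsHoleColoring b p c) (hik : i < k) {e' : D} {Ψ' : D → ℚ}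
    (hΨ : M.IsSide b p i k (MonoDart M c i k) e Ψ)
    (hΨ' : M.IsSide b p i k (MonoDart M c i k) e' Ψ')
    (he : c (M.src e) = i ∧ c (M.src (M.rev e)) = k)
    (he' : c (M.src e') = i ∧ c (M.src (M.rev e')) = k) {d : D} (ht : M.Terminal b c d)
    (hd : (c (M.src d) = i ∧ c (M.src (M.rev d)) = k) ∨
      (c (M.src d) = k ∧ c (M.src (M.rev d)) = i)) :
    Ψ d = Ψ' d ∧ (Ψ d = 0 ∨ Ψ d = 1) := by
  have hkp : k < p := he.2 ▸ h.color_lt _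
  by_cases hdb : M.face d = M.face b
  · obtain ⟨m, hm, rfl⟩ := (h.face_eq_iff d).1 hdb
    rw [hΨ.hole m hm, hΨ'.hole m hm]
    split_ifs <;> simp
  · have ht' := third_ne ht hdb
    rw [hΨ.eq_of_third h hik hkp (fun d hd => hd.2) he.1 he.2 hdb (by omega) (by omega),
      hΨ'.eq_of_third h hik hkp (fun d hd => hd.2) he'.1 he'.2 hdb (by omega) (by omega)]
    split_ifs <;> simp

-- Apply `balance` to `w ∘ Ψ`. Among the darts from colour `i` to colour `k`, only `e` crosses a
-- jump of `Ψ`. The freedom in `w` permits detecting single values of `Ψ`.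
open Classical in
theorem side_balance (h : M.IsHoleColoring b p c) (hik : i < k) {K : D → Prop}
    (hK : M.LinkClosed b c K) (hKe : K e) (hΨ : M.IsSide b p i k (MonoDart M c i k) e Ψ)
    (he : c (M.src e) = i ∧ c (M.src (M.rev e)) = k) (w : ℚ → ℚ) :
    w (Ψ e) - w (Ψ (M.rev e)) =
      ∑ d with M.Terminal b c d, w (Ψ d) * (dir M c K i k d - dir M c K i k (M.rev d)) := by
  rw [← h.balance hik.ne hK (g := fun d => w (Ψ d)) (fun d hd => by rw [hΨ.next d hd]),
    Finset.sum_eq_single e]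
  · rw [dir, if_pos ⟨hKe, he⟩, one_mul]
  · intro d _ hd
    by_cases hd' : K d ∧ c (M.src d) = i ∧ c (M.src (M.rev d)) = k
    · rw [hΨ.same d (fun hm => by have := hm.1; omega) hd (by rintro rfl; omega), sub_self,
        mul_zero]
    · rw [dir, if_neg hd', zero_mul]
  · simp

-- Choosing `w` as the indicator of a value `x` other than `0` and `1` makes every terminal
-- contribution vanish, so neither side of `e` has the value `x`. Two values in `{0, 1}` that differ
-- by one are determined.
open Classical in
theorem side_values [Finite V] (h : M.IsHoleColoring b p c) (hik : i < k)
    (hΨ : M.IsSide b p i k (MonoDart M c i k) e Ψ)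
    (he : c (M.src e) = i ∧ c (M.src (M.rev e)) = k) : Ψ e = 1 ∧ Ψ (M.rev e) = 0 := by
  have key : ∀ x : ℚ, x ≠ 0 → x ≠ 1 → x ≠ Ψ e ∧ x ≠ Ψ (M.rev e) := fun x h0 h1 => by
    have hb := h.side_balance hik (K := fun _ => True) ⟨fun _ _ => trivial, fun _ _ _ _ _ _ _ =>
      trivial⟩ trivial hΨ he (fun y => if y = x then 1 else 0)
    rw [Finset.sum_eq_zero] at hb
    · have := hΨ.cross
      refine ⟨fun hx => ?_, fun hx => ?_⟩
      · rw [if_pos hx.symm, if_neg (by rw [hx, this]; linarith)] at hb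
        norm_num at hb
      · rw [if_pos hx.symm, if_neg (by rw [hx, this]; linarith)] at hb
        norm_num at hb
    · intro d hd
      rw [Finset.mem_filter] at hd
      by_cases hd' : (c (M.src d) = i ∧ c (M.src (M.rev d)) = k) ∨
          (c (M.src d) = k ∧ c (M.src (M.rev d)) = i)
      · rw [if_neg, zero_mul]
        have := (h.side_terminal hik hΨ hΨ he he hd.2 hd').2
        rintro rfl
        exact this.elim h0 h1
      · have hd1 : ¬ (True ∧ c (M.src d) = i ∧ c (M.src (M.rev d)) = k) := by tauto
        have hd2 : ¬ (True ∧ c (M.src (M.rev d)) = i ∧ c (M.src d) = k) := by tauto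
        rw [dir, dir, M.rev_rev, if_neg hd1, if_neg hd2, sub_zero, mul_zero]
  have hc := hΨ.cross
  have h2 : Ψ (M.rev e) = 0 := by
    by_contra h0
    by_cases h1 : Ψ (M.rev e) = 1
    · have h3 : Ψ e = 2 := by rw [hc, h1]; norm_num
      exact (key (Ψ e) (by rw [h3]; norm_num) (by rw [h3]; norm_num)).1 rfl
    · exact (key _ h0 h1).2 rfl
  exact ⟨by rw [hc, h2, zero_add], h2⟩

end Side

variable [Finite V]

/-- By `side_terminal` the value does not depend on the crossing edge, so the circuit may be taken
through `d` itself, where `side_values` applies. -/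
theorem side_terminal_eq_one (h : M.IsHoleColoring b p c) {i k : ℕ} (hik : i < k) {e : D}
    {Ψ : D → ℚ} (hΨ : M.IsSide b p i k (MonoDart M c i k) e Ψ)
    (he : c (M.src e) = i ∧ c (M.src (M.rev e)) = k) {d : D} (ht : M.Terminal b c d)
    (hd : c (M.src d) = i ∧ c (M.src (M.rev d)) = k) : Ψ d = 1 := by
  obtain ⟨Ψ', hΨ'⟩ := h.exists_isSide hik hd.1 hd.2
  rw [(h.side_terminal hik hΨ hΨ' he hd ht (Or.inl hd)).1]
  exact (h.side_values hik hΨ' hd).1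

theorem side_terminal_eq_zero (h : M.IsHoleColoring b p c) {i k : ℕ} (hik : i < k) {e : D}
    {Ψ : D → ℚ} (hΨ : M.IsSide b p i k (MonoDart M c i k) e Ψ)
    (he : c (M.src e) = i ∧ c (M.src (M.rev e)) = k) {d : D} (ht : M.Terminal b c d)
    (hd : c (M.src d) = k ∧ c (M.src (M.rev d)) = i) : Ψ d = 0 := by
  have hd' : c (M.src (M.rev d)) = i ∧ c (M.src (M.rev (M.rev d))) = k := by
    rw [M.rev_rev]
    exact hd.symm
  obtain ⟨Ψ', hΨ'⟩ := h.exists_isSide hik hd'.1 hd'.2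
  rw [(h.side_terminal hik hΨ hΨ' he hd' ht (Or.inr hd)).1]
  have := (h.side_values hik hΨ' hd').2
  rwa [M.rev_rev] at this

/-- The third colour at a trichromatic face with a dart from a colour to a greater one lies
between them. -/
theorem third_between (h : M.IsHoleColoring b p c) {d : D} (ht : M.Terminal b c d)
    (hd : M.face d ≠ M.face b) (hlt : c (M.src d) < c (M.src (M.rev d))) :
    c (M.src d) < c (M.src (M.next (M.next d))) ∧
      c (M.src (M.next (M.next d))) < c (M.src (M.rev d)) := by
  obtain ⟨Ψ, hΨ⟩ := h.exists_isSide hlt rfl rfl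
  have h1 := h.side_terminal_eq_one hlt hΨ ⟨rfl, rfl⟩ ht ⟨rfl, rfl⟩
  have ht' := third_ne ht hd
  rw [hΨ.eq_of_third h hlt (h.color_lt _) (fun d hd => hd.2) rfl rfl hd ht'.1 ht'.2] at h1
  by_contra hn
  rw [if_neg hn] at h1
  norm_num at h1

-- Terminal darts have `Ψ = 1` in the direction `i → k` and `Ψ = 0` in the direction `k → i`.
-- Weights in `side_balance` that see only one of these values turn its right side into a count of
-- the terminal darts of `K` in one direction.
open Classical in
theorem existsUnique_terminal_of_lt (h : M.IsHoleColoring b p c) {K : D → Prop}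
    (hK : M.LinkClosed b c K) {e : D} (hKe : K e) {i k : ℕ} (hik : i < k)
    (he : c (M.src e) = i ∧ c (M.src (M.rev e)) = k) :
    (∃! d, M.Terminal b c d ∧ K d ∧ c (M.src d) = i ∧ c (M.src (M.rev d)) = k) ∧
      ∃! d, M.Terminal b c d ∧ K d ∧ c (M.src d) = k ∧ c (M.src (M.rev d)) = i := by
  obtain ⟨Ψ, hΨ⟩ := h.exists_isSide hik he.1 he.2
  have hv := h.side_values hik hΨ he
  have r : ∀ d, K (M.rev d) ↔ K d := fun d =>
    ⟨fun hd => by rw [← M.rev_rev d]; exact hK.rev _ hd, hK.rev d⟩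
  have hdir : ∀ d, dir M c K i k d - dir M c K i k (M.rev d) =
      (if K d ∧ c (M.src d) = i ∧ c (M.src (M.rev d)) = k then 1 else 0) -
        (if K d ∧ c (M.src d) = k ∧ c (M.src (M.rev d)) = i then 1 else 0) := fun d => by
    rw [dir, dir, M.rev_rev, r]
    congr 1
    exact if_congr (and_congr_right fun _ => and_comm) rfl rfl
  have card_one : ∀ Q : D → Prop, (∑ d with M.Terminal b c d, if Q d then (1 : ℚ) else 0) = 1 →
      ∃! d, M.Terminal b c d ∧ Q d := fun Q hQ => by
    rw [Finset.sum_boole, Finset.filter_filter, Nat.cast_eq_one, Finset.card_eq_one] at hQ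
    obtain ⟨a, ha⟩ := hQ
    have ha' : ∀ d, M.Terminal b c d ∧ Q d ↔ d = a := fun d => by
      simpa using congrArg (d ∈ ·) ha
    exact ⟨a, (ha' a).2 rfl, fun d hd => (ha' d).1 hd⟩
  refine ⟨card_one _ ?_, card_one _ ?_⟩
  · have hb := h.side_balance hik hK hKe hΨ he (fun x => if x = 1 then 1 else 0)
    rw [hv.1, hv.2, if_pos rfl, if_neg zero_ne_one, sub_zero] at hb
    refine Eq.trans (Finset.sum_congr rfl fun d hd => ?_) hb.symm
    rw [Finset.mem_filter] at hd
    rw [hdir]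
    by_cases h1 : K d ∧ c (M.src d) = i ∧ c (M.src (M.rev d)) = k
    · have h2 : ¬ (K d ∧ c (M.src d) = k ∧ c (M.src (M.rev d)) = i) := by omega
      simp only [h.side_terminal_eq_one hik hΨ he hd.2 h1.2, if_pos h1, if_neg h2]
      norm_num
    · simp only [if_neg h1]
      by_cases h2 : K d ∧ c (M.src d) = k ∧ c (M.src (M.rev d)) = i
      · rw [h.side_terminal_eq_zero hik hΨ he hd.2 h2.2, if_neg zero_ne_one, zero_mul]
      · simp only [if_neg h2, sub_zero, mul_zero]
  -- The weight is `-1` at `0` because darts `k → i` enter the balance with a negative sign.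
  · have hb := h.side_balance hik hK hKe hΨ he (fun x => if x = 0 then -1 else 0)
    rw [hv.1, hv.2, if_pos rfl, if_neg one_ne_zero, sub_neg_eq_add, zero_add] at hb
    refine Eq.trans (Finset.sum_congr rfl fun d hd => ?_) hb.symm
    rw [Finset.mem_filter] at hd
    rw [hdir]
    by_cases h1 : K d ∧ c (M.src d) = k ∧ c (M.src (M.rev d)) = i
    · have h2 : ¬ (K d ∧ c (M.src d) = i ∧ c (M.src (M.rev d)) = k) := by omega
      simp only [h.side_terminal_eq_zero hik hΨ he hd.2 h1.2, if_pos h1, if_neg h2]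
      norm_num
    · simp only [if_neg h1]
      by_cases h2 : K d ∧ c (M.src d) = i ∧ c (M.src (M.rev d)) = k
      · rw [h.side_terminal_eq_one hik hΨ he hd.2 h2.2, if_neg one_ne_zero, zero_mul]
      · simp only [if_neg h2, sub_zero, mul_zero]

theorem existsUnique_terminal (h : M.IsHoleColoring b p c) {K : D → Prop}
    (hK : M.LinkClosed b c K) {e : D} (hKe : K e) (he : c (M.src e) ≠ c (M.src (M.rev e))) :
    ∃! d, M.Terminal b c d ∧ K d ∧ c (M.src d) = c (M.src e) ∧
      c (M.src (M.rev d)) = c (M.src (M.rev e)) := by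
  rcases lt_or_gt_of_ne he with hlt | hlt
  · exact (h.existsUnique_terminal_of_lt hK hKe hlt ⟨rfl, rfl⟩).1
  · exact (h.existsUnique_terminal_of_lt hK (hK.rev e hKe) hlt ⟨rfl, by rw [M.rev_rev]⟩).2

theorem exists_terminal (h : M.IsHoleColoring b p c) {K : D → Prop}
    (hK : M.LinkClosed b c K) {e : D} (hKe : K e) (he : c (M.src e) ≠ c (M.src (M.rev e))) :
    ∃ d, M.Terminal b c d ∧ K d ∧ c (M.src d) = c (M.src e) ∧
      c (M.src (M.rev d)) = c (M.src (M.rev e)) :=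
  (h.existsUnique_terminal hK hKe he).exists

/-- Taking all darts for `K` makes uniqueness global, not only within one Voronoi edge. -/
theorem terminal_unique (h : M.IsHoleColoring b p c) {d e : D} (hd : M.Terminal b c d)
    (he : M.Terminal b c e) (hne : c (M.src e) ≠ c (M.src (M.rev e)))
    (h1 : c (M.src d) = c (M.src e)) (h2 : c (M.src (M.rev d)) = c (M.src (M.rev e))) : d = e :=
  (h.existsUnique_terminal (K := fun _ => True) ⟨fun _ _ => trivial, fun _ _ _ _ _ _ _ => trivial⟩
    trivial hne).unique ⟨hd, trivial, h1, h2⟩ ⟨he, trivial, rfl, rfl⟩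

end IsHoleColoring

end PlaneMap

/-! ### Survival and dangling pairs of colours -/

namespace PlaneMap

variable {V D : Type*} {M : PlaneMap V D} {b : D} {p : ℕ} {c : V → ℕ}

/-- The ends of the dart `d` have the colours `i` and `k`. -/
def HasColors (M : PlaneMap V D) (c : V → ℕ) (d : D) (i k : ℕ) : Prop :=
  (c (M.src d) = i ∧ c (M.src (M.rev d)) = k) ∨ (c (M.src d) = k ∧ c (M.src (M.rev d)) = i)

/-- A set `A` of terminal darts as it arises from the darts of the surviving nodes: it respects
faces, contains all darts of the hole except the last one, and with a dart between the colours
`i` and `k` contains all trichromatic faces with colours in `[i, k]`. -/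
structure IsSurvival (M : PlaneMap V D) (b : D) (p : ℕ) (c : V → ℕ) (A : D → Prop) : Prop where
  next : ∀ d, M.face d ≠ M.face b → (A (M.next d) ↔ A d)
  hole : ∀ m < p, A (M.next^[m] b) ↔ m + 1 < p
  between : ∀ d e i k, i < k → M.Terminal b c d → A d → M.HasColors c d i k →
    M.Terminal b c e → M.face e ≠ M.face b →
    (∀ x, M.face x = M.face e → i ≤ c (M.src x) ∧ c (M.src x) ≤ k) → A e

/-- The terminal dart from colour `i` to colour `k` survives and the one in the opposite direction
does not. -/
def Dangling (M : PlaneMap V D) (b : D) (c : V → ℕ) (A : D → Prop) (i k : ℕ) : Prop :=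
  i < k ∧ ∃ u v, M.Terminal b c u ∧ M.Terminal b c v ∧ (c (M.src u) = i ∧ c (M.src (M.rev u)) = k) ∧
    (c (M.src v) = k ∧ c (M.src (M.rev v)) = i) ∧ A u ∧ ¬ A v

/-- The node of the terminal dart `d` lies on the inner side of the colours `i < k`. -/
def Inner (M : PlaneMap V D) (b : D) (p : ℕ) (c : V → ℕ) (i k : ℕ) (d : D) : Prop :=
  (M.face d ≠ M.face b ∧ ∀ x, M.face x = M.face d → i ≤ c (M.src x) ∧ c (M.src x) ≤ k) ∨
    ∃ m, m + 1 < p ∧ i ≤ m ∧ m + 1 ≤ k ∧ d = M.next^[m] b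

theorem IsSurvival.of_inner {A : D → Prop} (hA : M.IsSurvival b p c A) {i k : ℕ}
    (hD : M.Dangling b c A i k) {d : D} (hd : M.Terminal b c d) (hdI : M.Inner b p c i k d) :
    A d := by
  obtain ⟨hik, u, -, hu, -, hu1, -, huA, -⟩ := hD
  rcases hdI with ⟨hdb, hdI⟩ | ⟨m, hm, -, -, rfl⟩
  · exact hA.between u d i k hik hu huA (Or.inl hu1) hd hdb hdI
  · exact (hA.hole m (by omega)).2 hm

variable [Fintype D]

namespace IsHoleColoring

theorem forall_face_iff (h : M.IsHoleColoring b p c) {d : D} (hd : M.face d ≠ M.face b)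
    {Q : V → Prop} : (∀ x, M.face x = M.face d → Q (M.src x)) ↔
      Q (M.src d) ∧ Q (M.src (M.rev d)) ∧ Q (M.src (M.next (M.next d))) := by
  rw [← M.src_next]
  constructor
  · intro hx
    exact ⟨hx _ rfl, hx _ (M.face_next d), hx _ (by rw [face_next, face_next])⟩
  · rintro ⟨h1, h2, h3⟩ x hx
    rcases (h.triangle _ hd).face_eq hx with rfl | rfl | rfl <;> assumption

theorem src_rev_next (h : M.IsHoleColoring b p c) {d : D} (hd : M.face d ≠ M.face b) :
    M.src (M.rev (M.next d)) = M.src (M.next (M.next d)) ∧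
      M.src (M.rev (M.next (M.next d))) = M.src d := by
  rw [← M.src_next, ← M.src_next, (h.triangle _ hd).next_next_next]
  exact ⟨rfl, rfl⟩

/-- A dart of the hole from a colour to a smaller one is the last one. -/
theorem hole_of_gt (h : M.IsHoleColoring b p c) {d : D} (hd : M.face d = M.face b)
    (hlt : c (M.src (M.rev d)) < c (M.src d)) :
    d = M.next^[p - 1] b ∧ c (M.src d) = p - 1 ∧ c (M.src (M.rev d)) = 0 := by
  obtain ⟨m, hm, rfl⟩ := (h.face_eq_iff d).1 hd
  rw [h.color_iterate hm] at hlt ⊢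
  by_cases hm' : m + 1 < p
  · rw [h.color_rev_iterate hm'] at hlt
    omega
  · obtain rfl : m = p - 1 := by omega
    exact ⟨rfl, rfl, h.color_rev_last⟩

theorem hole_of_lt (h : M.IsHoleColoring b p c) {d : D} (hd : M.face d = M.face b)
    (hlt : c (M.src d) < c (M.src (M.rev d))) :
    ∃ m, m + 1 < p ∧ d = M.next^[m] b ∧ c (M.src d) = m ∧ c (M.src (M.rev d)) = m + 1 := by
  obtain ⟨m, hm, rfl⟩ := (h.face_eq_iff d).1 hd
  by_cases hm' : m + 1 < p
  · exact ⟨m, hm', rfl, h.color_iterate hm, h.color_rev_iterate hm'⟩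
  · obtain rfl : m = p - 1 := by omega
    rw [h.color_rev_last] at hlt
    omega

theorem Inner.colors (h : M.IsHoleColoring b p c) {i k : ℕ} {d : D} (hd : M.Inner b p c i k d) :
    (i ≤ c (M.src d) ∧ c (M.src d) ≤ k) ∧
      i ≤ c (M.src (M.rev d)) ∧ c (M.src (M.rev d)) ≤ k := by
  rcases hd with ⟨hdb, hd⟩ | ⟨m, hm, h1, h2, rfl⟩
  · have := (h.forall_face_iff hdb (Q := fun v => i ≤ c v ∧ c v ≤ k)).1 hd
    exact ⟨this.1, this.2.1⟩
  · rw [h.color_iterate (by omega), h.color_rev_iterate hm]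
    omega

variable [Finite V] {A : D → Prop}

theorem not_cross' (h : M.IsHoleColoring b p c) {e d : D} {i k x y : ℕ} (hik : i < k)
    (he : M.HasColors c e i k) (hd : M.HasColors c d x y) (hx : i < x ∧ x < k) :
    i ≤ y ∧ y ≤ k := by
  have key : ∀ e, c (M.src e) = i → c (M.src (M.rev e)) = k → i ≤ y ∧ y ≤ k := by
    rintro e rfl rfl
    by_contra hy
    rcases hd with ⟨rfl, rfl⟩ | ⟨rfl, rfl⟩
    · have := h.not_cross hik (d := d) (by omega) (by omega) (by omega) (by omega)
      omega
    · have := h.not_cross hik (d := d) (by omega) (by omega) (by omega) (by omega)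
      omega
  rcases he with ⟨h1, h2⟩ | ⟨h1, h2⟩
  · exact key e h1 h2
  · exact key (M.rev e) h2 (by rwa [M.rev_rev])

/-- The third colour at the inner end lies between `i` and `k`, so survival of either end forces
survival of the inner one. Dangling edges are thus always cut at the outer end. -/
theorem survives_up (h : M.IsHoleColoring b p c) (hA : M.IsSurvival b p c A) {i k : ℕ} (hik : i < k)
    {d e : D} (hd : M.Terminal b c d) (he : M.Terminal b c e) (hdA : A d)
    (hdc : M.HasColors c d i k) (hec : c (M.src e) = i ∧ c (M.src (M.rev e)) = k) : A e := by
  obtain ⟨rfl, rfl⟩ := hec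
  by_cases heb : M.face e = M.face b
  · obtain ⟨m, hm, rfl, -⟩ := h.hole_of_lt heb hik
    exact (hA.hole m (by omega)).2 hm
  · refine hA.between d e _ _ hik hd hdA hdc he heb ((h.forall_face_iff heb
      (Q := fun v => c (M.src e) ≤ c v ∧ c v ≤ c (M.src (M.rev e)))).2 ?_)
    have := h.third_between he heb hik
    omega

/-- If `k < l`, the outer end of the edge `{i, k}` is nested inside the edge `{i, l}`: a third
colour outside `[i, l]` would give an edge from class `k` crossing it. As `{i, l}` has a surviving
end, that outer end survives too, a contradiction. -/
theorem dangling_up_unique (h : M.IsHoleColoring b p c) (hA : M.IsSurvival b p c A) {i k l : ℕ}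
    (hk : M.Dangling b c A i k) (hl : M.Dangling b c A i l) : k = l := by
  wlog hkl : k < l generalizing k l
  · rcases Nat.lt_trichotomy k l with hlt | heq | hlt
    · exact this hk hl hlt
    · exact heq
    · exact (this hl hk hlt).symm
  obtain ⟨hik, -, v, -, hv, -, ⟨hv1, hv2⟩, -, hvA⟩ := hk
  obtain ⟨hil, u, -, hu, -, hu1, -, huA, -⟩ := hl
  have hlp : l < p := hu1.2 ▸ h.color_lt _
  exfalso
  by_cases hvb : M.face v = M.face b
  · have := h.hole_of_gt hvb (by omega)
    omega
  · refine hvA (hA.between u v i l hil hu huA (Or.inl hu1) hv hvb ((h.forall_face_iff hvb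
      (Q := fun v => i ≤ c v ∧ c v ≤ l)).2 ⟨by omega, by omega, ?_⟩))
    exact h.not_cross' hil (Or.inl hu1) (d := M.next (M.next v)) (x := k)
      (Or.inr ⟨rfl, by rw [(h.src_rev_next hvb).2, hv1]⟩) ⟨hik, hkl⟩

theorem dangling_down_unique (h : M.IsHoleColoring b p c) (hA : M.IsSurvival b p c A) {i k l : ℕ}
    (hk : M.Dangling b c A k i) (hl : M.Dangling b c A l i) : k = l := by
  wlog hkl : k < l generalizing k l
  · rcases Nat.lt_trichotomy k l with hlt | heq | hlt
    · exact this hk hl hlt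
    · exact heq
    · exact (this hl hk hlt).symm
  obtain ⟨hli, -, v, -, hv, -, ⟨hv1, hv2⟩, -, hvA⟩ := hl
  obtain ⟨hki, u, -, hu, -, hu1, -, huA, -⟩ := hk
  exfalso
  by_cases hvb : M.face v = M.face b
  · have := h.hole_of_gt hvb (by omega)
    omega
  · refine hvA (hA.between u v k i hki hu huA (Or.inl hu1) hv hvb ((h.forall_face_iff hvb
      (Q := fun v => k ≤ c v ∧ c v ≤ i)).2 ⟨by omega, by omega, ?_⟩))
    exact h.not_cross' hki (Or.inl hu1) (d := M.next v) (x := l)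
      (Or.inl ⟨by rw [M.src_next, hv2], by rw [(h.src_rev_next hvb).1]⟩) ⟨hkl, hli⟩

theorem inner_of_lt (h : M.IsHoleColoring b p c) {d : D} (hd : M.Terminal b c d)
    (hlt : c (M.src d) < c (M.src (M.rev d))) :
    M.Inner b p c (c (M.src d)) (c (M.src (M.rev d))) d := by
  by_cases hdb : M.face d = M.face b
  · obtain ⟨m, hm, rfl, h1, h2⟩ := h.hole_of_lt hdb hlt
    exact Or.inr ⟨m, hm, by omega, by omega, rfl⟩
  · refine Or.inl ⟨hdb, (h.forall_face_iff hdb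
      (Q := fun v => c (M.src d) ≤ c v ∧ c v ≤ c (M.src (M.rev d)))).2 ?_⟩
    have := h.third_between hd hdb hlt
    omega

/-- The end of a Voronoi edge with an inner end is inner or the outer end of the edge between the
colours `i` and `k`. -/
theorem inner_or_eq (h : M.IsHoleColoring b p c) {i k : ℕ} (hik : i < k) {u : D}
    (hu : M.HasColors c u i k) {d e : D} (hdI : M.Inner b p c i k d) (he : M.Terminal b c e)
    (hne : c (M.src e) ≠ c (M.src (M.rev e)))
    (hde : M.HasColors c d (c (M.src e)) (c (M.src (M.rev e)))) :
    M.Inner b p c i k e ∨ (c (M.src e) = k ∧ c (M.src (M.rev e)) = i) := by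
  have hdc := Inner.colors h hdI
  have hec : (i ≤ c (M.src e) ∧ c (M.src e) ≤ k) ∧
      i ≤ c (M.src (M.rev e)) ∧ c (M.src (M.rev e)) ≤ k := by
    unfold HasColors at hde
    omega
  by_cases heb : M.face e = M.face b
  · rcases lt_or_gt_of_ne hne with hlt | hlt
    · obtain ⟨m, hm, rfl, h1, h2⟩ := h.hole_of_lt heb hlt
      exact Or.inl (Or.inr ⟨m, hm, by omega, by omega, rfl⟩)
    · have := h.hole_of_gt heb hlt
      have hkp : k < p := by
        rcases hu with hu | hu
        · exact hu.2 ▸ h.color_lt _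
        · exact hu.1 ▸ h.color_lt _
      omega
  · rw [or_iff_not_imp_right]
    intro hki
    have hn := h.src_rev_next heb
    have ht := third_ne he heb
    refine Or.inl ⟨heb, (h.forall_face_iff heb (Q := fun v => i ≤ c v ∧ c v ≤ k)).2
      ⟨hec.1, hec.2, ?_⟩⟩
    -- If an end of `e` has a colour strictly between `i` and `k`, non-crossing confines the third
    -- colour. Otherwise the ends have exactly the colours `i` and `k`, in this order by `hki`, and
    -- `third_between` applies.
    by_cases h1 : i < c (M.src e) ∧ c (M.src e) < k
    · exact h.not_cross' hik hu (d := M.next (M.next e)) (Or.inr ⟨rfl, by rw [hn.2]⟩) h1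
    by_cases h2 : i < c (M.src (M.rev e)) ∧ c (M.src (M.rev e)) < k
    · exact h.not_cross' hik hu (d := M.next e) (Or.inl ⟨by rw [M.src_next], by rw [hn.1]⟩) h2
    have := h.third_between he heb (by omega)
    omega

end IsHoleColoring

end PlaneMap

/-! ### Signed count of dangling edges -/

namespace PlaneMap

variable {V D : Type*} {M : PlaneMap V D} {b : D} {p : ℕ} {c : V → ℕ}

namespace IsHoleColoring

variable [Fintype D] {A : D → Prop}

open Classical in
/-- Signed count of the surviving terminal darts at the colour `i`. -/
theorem sum_survivors (h : M.IsHoleColoring b p c) (hA : M.IsSurvival b p c A) (i : ℕ) :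
    (∑ d, (if M.Terminal b c d ∧ A d then (1 : ℚ) else 0) *
      ((if c (M.src d) = i then 1 else 0) - (if c (M.src (M.rev d)) = i then 1 else 0))) =
    (if i = 0 then 1 else 0) - (if i = p - 1 then 1 else 0) := by
  have hp := h.two_le
  set f : D → ℚ := fun d =>
    (if c (M.src d) = i then 1 else 0) - (if c (M.src (M.rev d)) = i then 1 else 0) with hf
  -- A triangle is a closed walk, so each colour is the tail and the head of equally many of its
  -- darts.
  have h1 : ∑ d, (if M.face d = M.face b then 0 else
      if M.Terminal b c d ∧ A d then (1 : ℚ) else 0) * f d = 0 := by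
    refine sum_eq_zero (b := b) (fun d hd => ?_) (fun d hd => if_pos hd) (fun d hd _ => ?_)
    · rw [face_next]
      refine if_congr Iff.rfl rfl (if_congr ?_ rfl rfl)
      rw [h.terminal_next, hA.next d hd]
    · simp only [hf, (h.src_rev_next hd).1, (h.src_rev_next hd).2, M.src_next d]
      ring
  have h2 : ∑ d with M.face d = M.face b, (if M.Terminal b c d ∧ A d then (1 : ℚ) else 0) * f d =
      ∑ m ∈ Finset.range p, if m + 1 < p then
        (if m = i then (1 : ℚ) else 0) - (if m + 1 = i then 1 else 0) else 0 := by
    symm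
    refine Finset.sum_bij (fun m _ => M.next^[m] b) (fun m hm => ?_) (fun m hm l hl hml => ?_)
      (fun d hd => ?_) (fun m hm => ?_)
    · exact Finset.mem_filter.2 ⟨Finset.mem_univ _, M.face_iterate b m⟩
    · exact h.injOn (by simpa using hm) (by simpa using hl) hml
    · obtain ⟨m, hm, rfl⟩ := (h.face_eq_iff d).1 (by simpa using hd)
      exact ⟨m, by simpa using hm, rfl⟩
    · rw [Finset.mem_range] at hm
      by_cases hm' : m + 1 < p
      · have ht : M.Terminal b c (M.next^[m] b) ∧ A (M.next^[m] b) :=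
          ⟨Or.inl (M.face_iterate b m), (hA.hole m hm).2 hm'⟩
        rw [if_pos hm', if_pos ht, one_mul, hf]
        simp only [h.color_iterate hm, h.color_rev_iterate hm']
      · rw [if_neg hm', if_neg (fun h' => hm' ((hA.hole m hm).1 h'.2)), zero_mul]
  -- Without its last dart, which does not survive, the hole is a path from colour `0` to colour `p
  -- - 1`, and the count telescopes.
  have h3 : ∑ m ∈ Finset.range p, (if m + 1 < p then
        (if m = i then (1 : ℚ) else 0) - (if m + 1 = i then 1 else 0) else 0) =
      (if i = 0 then 1 else 0) - (if i = p - 1 then 1 else 0) := by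
    obtain ⟨n, rfl⟩ : ∃ n, p = n + 1 := ⟨p - 1, by omega⟩
    rw [Finset.sum_range_succ, if_neg (lt_irrefl _), add_zero, Finset.sum_congr rfl
      (g := fun m => (if m = i then (1 : ℚ) else 0) - (if m + 1 = i then 1 else 0))
      (fun m hm => if_pos (by rw [Finset.mem_range] at hm; omega)),
      Finset.sum_range_sub' (fun m => if m = i then (1 : ℚ) else 0)]
    simp only [Nat.add_sub_cancel, eq_comm]
  rw [← h3, ← h2, Finset.sum_filter]
  refine Eq.trans ?_ ((congrArg (_ + ·) h1).trans (add_zero _))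
  simp only [← Finset.sum_add_distrib]
  refine Finset.sum_congr rfl fun d _ => ?_
  by_cases hd : M.face d = M.face b
  · simp only [if_pos hd, zero_mul, add_zero, hf]
  · simp only [if_neg hd, zero_add, hf]

variable [Finite V]

open Classical in
theorem sum_survivors_pair (h : M.IsHoleColoring b p c) {i k : ℕ} (hik : i ≠ k) :
    (∑ d, (if M.Terminal b c d ∧ A d then (1 : ℚ) else 0) *
      (if c (M.src d) = i ∧ c (M.src (M.rev d)) = k then 1 else 0)) =
    if ∃ d, M.Terminal b c d ∧ A d ∧ c (M.src d) = i ∧ c (M.src (M.rev d)) = k then 1 else 0 := by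
  split_ifs with hex
  · obtain ⟨e, he, heA, h1, h2⟩ := hex
    rw [Finset.sum_eq_single e]
    · simp [he, heA, h1, h2]
    · intro d _ hd
      by_contra hn
      have hd1 : (M.Terminal b c d ∧ A d) ∧ c (M.src d) = i ∧ c (M.src (M.rev d)) = k := by
        by_contra h'
        rw [not_and_or] at h'
        rcases h' with h' | h'
        · exact hn (by rw [if_neg h', zero_mul])
        · exact hn (by rw [if_neg h', mul_zero])
      exact hd (h.terminal_unique hd1.1.1 he (by omega) (by omega) (by omega))
    · simp
  · refine Finset.sum_eq_zero fun d _ => ?_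
    by_cases h1 : M.Terminal b c d ∧ A d
    · have h2 : ¬ (c (M.src d) = i ∧ c (M.src (M.rev d)) = k) := fun h2 =>
        hex ⟨d, h1.1, h1.2, h2.1, h2.2⟩
      rw [if_neg h2, mul_zero]
    · rw [if_neg h1, zero_mul]

-- A surviving outer end implies a surviving inner end, so the difference is never negative; it is
-- `1` exactly when only the inner end survives.
open Classical in
theorem pair_sub_pair (h : M.IsHoleColoring b p c) (hA : M.IsSurvival b p c A) {i k : ℕ}
    (hik : i < k) :
    ((if ∃ d, M.Terminal b c d ∧ A d ∧ c (M.src d) = i ∧ c (M.src (M.rev d)) = k then (1 : ℚ)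
      else 0) -
      if ∃ d, M.Terminal b c d ∧ A d ∧ c (M.src d) = k ∧ c (M.src (M.rev d)) = i then 1 else 0) =
    if M.Dangling b c A i k then 1 else 0 := by
  have hK : M.LinkClosed b c (fun _ => True) := ⟨fun _ _ => trivial, fun _ _ _ _ _ _ _ => trivial⟩
  by_cases h2 : ∃ d, M.Terminal b c d ∧ A d ∧ c (M.src d) = k ∧ c (M.src (M.rev d)) = i
  · obtain ⟨v, hv, hvA, hv1, hv2⟩ := h2
    obtain ⟨u, hu, -, hu1, hu2⟩ := h.exists_terminal hK (e := M.rev v) trivial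
      (by rw [M.rev_rev]; omega)
    rw [M.rev_rev] at hu2
    have huA := h.survives_up hA hik hv hu hvA (Or.inr ⟨hv1, hv2⟩) ⟨by omega, by omega⟩
    rw [if_pos ⟨u, hu, huA, by omega, by omega⟩, if_pos ⟨v, hv, hvA, hv1, hv2⟩, if_neg, sub_self]
    rintro ⟨-, -, v', -, hv', -, hv1', -, hvA'⟩
    exact hvA' (h.terminal_unique hv' hv (by omega) (by omega) (by omega) ▸ hvA)
  · rw [if_neg h2, sub_zero]
    refine if_congr ⟨?_, ?_⟩ rfl rfl
    · rintro ⟨u, hu, huA, hu1, hu2⟩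
      obtain ⟨v, hv, -, hv1, hv2⟩ := h.exists_terminal hK (e := M.rev u) trivial
        (by rw [M.rev_rev]; omega)
      rw [M.rev_rev] at hv2
      exact ⟨hik, u, v, hu, hv, ⟨hu1, hu2⟩, ⟨by omega, by omega⟩, huA,
        fun hvA => h2 ⟨v, hv, hvA, by omega, by omega⟩⟩
    · rintro ⟨-, u, -, hu, -, ⟨hu1, hu2⟩, -, huA, -⟩
      exact ⟨u, hu, huA, hu1, hu2⟩

open Classical in
theorem sum_dangling (h : M.IsHoleColoring b p c) (hA : M.IsSurvival b p c A) {i : ℕ} :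
    (∑ k ∈ Finset.range p, if M.Dangling b c A i k then (1 : ℚ) else 0) -
      (∑ k ∈ Finset.range p, if M.Dangling b c A k i then 1 else 0) =
    (if i = 0 then 1 else 0) - (if i = p - 1 then 1 else 0) := by
  rw [← h.sum_survivors hA, ← Finset.sum_sub_distrib]
  have h1 : ∀ d, (if c (M.src d) = i then (1 : ℚ) else 0) -
      (if c (M.src (M.rev d)) = i then 1 else 0) = ∑ k ∈ Finset.range p,
        ((if c (M.src d) = i ∧ c (M.src (M.rev d)) = k then 1 else 0) -
          (if c (M.src d) = k ∧ c (M.src (M.rev d)) = i then 1 else 0)) := fun d => by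
    rw [Finset.sum_sub_distrib, Finset.sum_eq_single (c (M.src (M.rev d))),
      Finset.sum_eq_single (c (M.src d))]
    · simp
    · intro k _ hk
      simp [hk.symm]
    · simp [h.color_lt]
    · intro k _ hk
      simp [hk.symm]
    · simp [h.color_lt]
  simp only [h1, Finset.mul_sum]
  rw [Finset.sum_comm]
  refine Finset.sum_congr rfl fun k _ => ?_
  simp only [mul_sub, Finset.sum_sub_distrib]
  rcases Nat.lt_trichotomy i k with hik | rfl | hik
  · rw [h.sum_survivors_pair hik.ne, h.sum_survivors_pair hik.ne', h.pair_sub_pair hA hik,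
      if_neg (c := M.Dangling b c A k i) (fun hD => by have := hD.1; omega), sub_zero]
  · simp
  · rw [h.sum_survivors_pair hik.ne, h.sum_survivors_pair hik.ne',
      if_neg (c := M.Dangling b c A i k) (fun hD => by have := hD.1; omega)]
    linarith [h.pair_sub_pair hA hik]

open Classical in
/-- The numbers of dangling edges from the colour `i` to greater and to smaller colours. -/
theorem exists_dangling_sub (h : M.IsHoleColoring b p c) (hA : M.IsSurvival b p c A) {i : ℕ} :
    (if ∃ k, M.Dangling b c A i k then (1 : ℚ) else 0) -
      (if ∃ k, M.Dangling b c A k i then 1 else 0) =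
    (if i = 0 then 1 else 0) - (if i = p - 1 then 1 else 0) := by
  rw [← h.sum_dangling hA]
  have key : ∀ Q : ℕ → Prop, (∀ k, Q k → k < p) → (∀ k l, Q k → Q l → k = l) →
      (∑ k ∈ Finset.range p, if Q k then (1 : ℚ) else 0) = if ∃ k, Q k then 1 else 0 := by
    intro Q h1 h2
    split_ifs with hex
    · obtain ⟨k, hk⟩ := hex
      rw [Finset.sum_eq_single k, if_pos hk]
      · exact fun l _ hl => if_neg fun hQ => hl (h2 l k hQ hk)
      · exact fun hn => (hn (Finset.mem_range.2 (h1 k hk))).elim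
    · exact Finset.sum_eq_zero fun k _ => if_neg fun hk => hex ⟨k, hk⟩
  rw [key _ _ fun k l hk hl => h.dangling_up_unique hA hk hl,
    key _ _ fun k l hk hl => h.dangling_down_unique hA hk hl]
  · rintro k ⟨-, u, -, -, -, ⟨rfl, -⟩, -⟩
    exact h.color_lt _
  · rintro k ⟨-, u, -, -, -, ⟨-, rfl⟩, -⟩
    exact h.color_lt _

end IsHoleColoring

end PlaneMap

/-! ### From colourings to dual Voronoi diagrams -/

section

open PlaneMap

namespace VoronoiInput

variable {V D : Type*} {M : PlaneMap V D} {I : VoronoiInput M} {b : D} {p : ℕ} {c : V → ℕ}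

/-- The colouring `c` describes the Voronoi cells of the vertices of the hole of the dart `b`. -/
structure IsCellColoring (I : VoronoiInput M) (b : D) (p : ℕ) (c : V → ℕ) : Prop where
  coloring : M.IsHoleColoring b p c
  hole : I.hole = M.face b
  sameCell : ∀ u v, I.SameCell u v ↔ c u = c v
  cell : ∀ v, ∀ i < p, v ∈ I.cell (M.bdry b i) ↔ c v = i

/-- The dart `d` belongs to a surviving node. -/
def Alive (I : VoronoiInput M) (deleted : Set I.Node) (d : D) : Prop :=
  ∃ n : I.Node, d ∈ n.darts ∧ n ∉ deleted

theorem Node.eq_of_mem {n m : I.Node} {d : D} (hn : d ∈ n.darts) (hm : d ∈ m.darts) : n = m := by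
  cases n with
  | leaf x hx =>
    obtain rfl : d = x := hn
    cases m with
    | leaf y hy =>
      obtain rfl : d = y := hm
      rfl
    | tri g hg =>
      have : M.face d = g := hm
      exact (hg.1 (this ▸ hx.1)).elim
  | tri f hf =>
    obtain rfl : M.face d = f := hn
    cases m with
    | leaf y hy =>
      obtain rfl : d = y := hm
      exact (hf.1 hy.1).elim
    | tri g hg =>
      obtain rfl : M.face d = g := hm
      rfl

theorem not_alive {deleted : Set I.Node} {n : I.Node} {d : D} (hn : d ∈ n.darts)
    (h : n ∈ deleted) : ¬ I.Alive deleted d := by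
  rintro ⟨m, hm, hm'⟩
  exact hm' (Node.eq_of_mem hn hm ▸ h)

namespace IsCellColoring

theorem bichromatic_iff (h : I.IsCellColoring b p c) (d : D) :
    I.Bichromatic d ↔ c (M.src d) ≠ c (M.src (M.rev d)) := by
  rw [Bichromatic, h.sameCell]

theorem inner_of_mem (h : I.IsCellColoring b p c) {i k : ℕ} {n : I.Node} {d e : D} (hd : d ∈ n.darts) (he : e ∈ n.darts)
    (hI : M.Inner b p c i k d) : M.Inner b p c i k e := by
  cases n with
  | leaf x hx =>
    obtain rfl : d = x := hd
    obtain rfl : e = d := he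
    exact hI
  | tri f hf =>
    by_cases hde : e = d
    · exact hde ▸ hI
    obtain rfl : M.face d = f := hd
    have he : M.face e = M.face d := he
    rcases hI with ⟨h1, h2⟩ | ⟨m, hm, h1, h2, rfl⟩
    · left
      rw [he]
      exact ⟨h1, h2⟩
    · exact (hf.1 (by rw [h.hole, M.face_iterate])).elim

variable [Fintype D]

theorem trichromatic_iff (h : I.IsCellColoring b p c) {d : D} (hd : M.face d ≠ M.face b) :
    I.Trichromatic (M.face d) ↔ M.Terminal b c d := by
  have ht := h.coloring.triangle _ hd
  have h1 := ht.next_ne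
  have h2 : M.next (M.next d) ≠ M.next d := fun h' => h1 (M.next.injective h')
  have h3 : M.next (M.next d) ≠ d := fun h' => h1 (by
    have := ht.next_next_next
    rwa [h'] at this)
  simp only [Trichromatic, Terminal, hd, false_or, h.hole, h.sameCell]
  constructor
  · rintro ⟨-, -, h'⟩
    refine ⟨h' _ rfl _ (M.face_next d) h1.symm, h' _ (M.face_next d) _ ?_ h2.symm,
      h' _ rfl _ ?_ h3.symm⟩ <;>
    · change M.face _ = _
      rw [face_next, face_next]
  · rintro ⟨k1, k2, k3⟩
    refine ⟨hd, ht, fun x hx y hy hxy => ?_⟩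
    rcases ht.face_eq hx with rfl | rfl | rfl <;> rcases ht.face_eq hy with rfl | rfl | rfl <;>
      first | exact (hxy rfl).elim | assumption | (apply Ne.symm; assumption)

theorem terminal_of_mem (h : I.IsCellColoring b p c) {n : I.Node} {d : D} (hn : d ∈ n.darts) :
    M.Terminal b c d ∧ c (M.src d) ≠ c (M.src (M.rev d)) := by
  cases n with
  | leaf x hx =>
    obtain rfl : d = x := hn
    exact ⟨Or.inl (hx.1.trans h.hole), (h.bichromatic_iff d).1 hx.2⟩
  | tri f hf =>
    obtain rfl : M.face d = f := hn
    have hd : M.face d ≠ M.face b := by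
      rw [← h.hole]
      exact hf.1
    have ht := (h.trichromatic_iff hd).1 hf
    refine ⟨ht, ?_⟩
    rw [← M.src_next]
    exact (ht.resolve_left hd).1

theorem exists_node (h : I.IsCellColoring b p c) {d : D} (hd : M.Terminal b c d)
    (hne : c (M.src d) ≠ c (M.src (M.rev d))) : ∃ n : I.Node, d ∈ n.darts := by
  by_cases hdb : M.face d = M.face b
  · exact ⟨.leaf d ⟨hdb.trans h.hole.symm, (h.bichromatic_iff d).2 hne⟩, rfl⟩
  · exact ⟨.tri (M.face d) ((h.trichromatic_iff hdb).2 hd), rfl⟩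

/-- Passing through a triangle with only two colours keeps the pair of colours, so each Voronoi edge
has a well-defined unordered pair. -/
theorem sym2_eq_of_link (h : I.IsCellColoring b p c) {d e : {d : D // I.Bichromatic d}}
    (hde : I.Link d e) : s(c (M.src d.1), c (M.src (M.rev d.1))) =
      s(c (M.src e.1), c (M.src (M.rev e.1))) := by
  rcases hde with hde | ⟨h1, h2, h3⟩
  · rw [hde, M.rev_rev, Sym2.eq_swap]
  · obtain ⟨d, hd⟩ := d
    obtain ⟨e, he⟩ := e
    simp only at h1 h2 h3 ⊢
    rw [h.hole] at h2
    rw [h.trichromatic_iff h2] at h3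
    rw [h.bichromatic_iff] at hd he
    have hs := h.coloring.src_rev_next h2
    simp only [Terminal, h2, false_or, M.src_next d] at h3
    rw [Sym2.eq_iff]
    rcases (h.coloring.triangle _ h2).face_eq h1.symm with rfl | rfl | rfl
    · exact Or.inl ⟨rfl, rfl⟩
    · rw [hs.1, M.src_next d] at he ⊢
      omega
    · rw [hs.2] at he ⊢
      omega

theorem hasColors_of_mk_eq (h : I.IsCellColoring b p c) {d e : {d : D // I.Bichromatic d}}
    (hde : Quot.mk I.Link d = Quot.mk I.Link e) :
    M.HasColors c d.1 (c (M.src e.1)) (c (M.src (M.rev e.1))) := by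
  have := congrArg (Quot.lift (fun d : {d : D // I.Bichromatic d} =>
    s(c (M.src d.1), c (M.src (M.rev d.1)))) fun _ _ => h.sym2_eq_of_link) hde
  exact Sym2.eq_iff.1 this

theorem linkClosed (h : I.IsCellColoring b p c) (E : I.VEdge) :
    M.LinkClosed b c (fun d => ∃ hd : I.Bichromatic d, Quot.mk I.Link ⟨d, hd⟩ = E) where
  rev := by
    rintro d ⟨hd, rfl⟩
    have hd' : I.Bichromatic (M.rev d) := by
      rw [h.bichromatic_iff, M.rev_rev] at *
      exact hd.symm
    exact ⟨hd', Eq.symm (Quot.sound (Or.inl rfl))⟩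
  face := by
    rintro d e ht hf hd he ⟨hd', rfl⟩
    have hdb : M.face d ≠ M.face b := fun h' => ht (Or.inl h')
    refine ⟨(h.bichromatic_iff e).2 he, Eq.symm (Quot.sound (Or.inr ⟨hf, ?_, ?_⟩))⟩
    · rwa [h.hole]
    · rwa [h.trichromatic_iff hdb]

variable [Finite V]

/-- Each of the two link classes contains a terminal dart with the ordered colours of `d`. Such a
dart is unique in the whole graph, so the classes meet. -/
theorem mk_eq_of_hasColors (h : I.IsCellColoring b p c) {d e : {d : D // I.Bichromatic d}}
    (hde : M.HasColors c d.1 (c (M.src e.1)) (c (M.src (M.rev e.1)))) :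
    Quot.mk I.Link d = Quot.mk I.Link e := by
  have hd := (h.bichromatic_iff _).1 d.2
  have he := (h.bichromatic_iff _).1 e.2
  obtain ⟨u, hu, ⟨hub, huE⟩, hu1, hu2⟩ :=
    h.coloring.exists_terminal (h.linkClosed (Quot.mk I.Link d)) ⟨d.2, rfl⟩ hd
  have key : ∃ v, M.Terminal b c v ∧ (∃ hv : I.Bichromatic v, Quot.mk I.Link ⟨v, hv⟩ =
      Quot.mk I.Link e) ∧ c (M.src v) = c (M.src d.1) ∧
      c (M.src (M.rev v)) = c (M.src (M.rev d.1)) := by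
    rcases hde with ⟨h1, h2⟩ | ⟨h1, h2⟩
    · rw [h1, h2]
      exact h.coloring.exists_terminal (h.linkClosed (Quot.mk I.Link e)) ⟨e.2, rfl⟩ he
    · have := h.coloring.exists_terminal (h.linkClosed (Quot.mk I.Link e)) (e := M.rev e.1)
        ((h.linkClosed (Quot.mk I.Link e)).rev _ ⟨e.2, rfl⟩) (by rw [M.rev_rev]; exact he.symm)
      rw [M.rev_rev] at this
      rwa [h1, h2]
  obtain ⟨v, hv, ⟨hvb, hvE⟩, hv1, hv2⟩ := key
  obtain rfl := h.coloring.terminal_unique hu hv (by omega) (by omega) (by omega)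
  exact huE.symm.trans hvE

variable {deleted : Set I.Node}

/-- The surviving and the deleted end carry opposite ordered colours, by uniqueness of terminal
darts; `survives_up` excludes that the deleted one is the inner end. -/
theorem exists_dangling (h : I.IsCellColoring b p c)
    (hA : M.IsSurvival b p c (I.Alive deleted)) {E : I.VEdge} (hE : I.IsDangling deleted E) :
    ∃ i k, M.Dangling b c (I.Alive deleted) i k ∧
      ∃ d : {d : D // I.Bichromatic d}, Quot.mk I.Link d = E ∧
        c (M.src d.1) = i ∧ c (M.src (M.rev d.1)) = k := by
  obtain ⟨⟨n, ⟨d, hd, hdn⟩, hn⟩, ⟨m, ⟨e, he, hem⟩, hm⟩⟩ := hE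
  have hde := h.hasColors_of_mk_eq (hd.trans he.symm)
  have hdA := not_alive hdn hn
  have heA : I.Alive deleted e.1 := ⟨m, hem, hm⟩
  obtain ⟨hdt, hdne⟩ := h.terminal_of_mem hdn
  obtain ⟨het, hene⟩ := h.terminal_of_mem hem
  have hne : ¬ (c (M.src d.1) = c (M.src e.1) ∧ c (M.src (M.rev d.1)) = c (M.src (M.rev e.1))) :=
    fun h' => hdA (h.coloring.terminal_unique hdt het hene h'.1 h'.2 ▸ heA)
  have hrev := hde.resolve_left hne
  rcases lt_or_gt_of_ne hene with hlt | hlt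
  · exact ⟨_, _, ⟨hlt, e.1, d.1, het, hdt, ⟨rfl, rfl⟩, hrev, heA, hdA⟩, e, he, rfl, rfl⟩
  · exact (hdA (h.coloring.survives_up hA hlt het hdt heA (Or.inr ⟨rfl, rfl⟩) hrev)).elim

theorem isDangling_of_dangling (h : I.IsCellColoring b p c) {i k : ℕ}
    (hD : M.Dangling b c (I.Alive deleted) i k) :
    ∃ d : {d : D // I.Bichromatic d}, I.IsDangling deleted (Quot.mk I.Link d) ∧
        c (M.src d.1) = i ∧ c (M.src (M.rev d.1)) = k := by
  obtain ⟨hik, u, v, hu, hv, hu1, hv1, ⟨n, hn, hn'⟩, hvA⟩ := hD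
  have hub : I.Bichromatic u := by rw [h.bichromatic_iff]; omega
  have hvb : I.Bichromatic v := by rw [h.bichromatic_iff]; omega
  obtain ⟨m, hm⟩ := h.exists_node hv (by omega)
  refine ⟨⟨u, hub⟩, ⟨⟨m, ⟨⟨v, hvb⟩, h.mk_eq_of_hasColors (Or.inr ?_), hm⟩, ?_⟩,
    n, ⟨⟨u, hub⟩, rfl, hn⟩, hn'⟩, hu1⟩
  · change c (M.src v) = c (M.src (M.rev u)) ∧ c (M.src (M.rev v)) = c (M.src u)
    omega
  · by_contra hmd
    exact hvA ⟨m, hm, hmd⟩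

/-- Each surviving component contains at most one dangling edge. -/
theorem danglingOf_subsingleton (h : I.IsCellColoring b p c)
    (hA : M.IsSurvival b p c (I.Alive deleted))
    (C : (I.graph.induce deletedᶜ).ConnectedComponent) :
    (I.danglingOf deleted C).Subsingleton := by
  rintro E₁ ⟨hE₁, n₁, hn₁, rfl⟩ E₂ ⟨⟨⟨m, ⟨e₂, he₂, hem⟩, hm⟩, -⟩, n₂, hn₂, hC⟩
  obtain ⟨i, k, hD, d₁, hd₁, hd₁i, hd₁k⟩ := h.exists_dangling hA hE₁
  have hD' := hD
  obtain ⟨hik, u, v, hu, hv, hu1, hv1, huA, hvA⟩ := hD'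
  have houter : ∀ n : I.Node, n ∉ deleted → ∀ d ∈ n.darts,
      ¬ (c (M.src d) = k ∧ c (M.src (M.rev d)) = i) := fun n hn d hd hdc => by
    obtain rfl := h.coloring.terminal_unique (h.terminal_of_mem hd).1 hv (by omega) (by omega)
      (by omega)
    exact hvA ⟨n, hd, hn⟩
  -- The outer end of `E₁` is deleted by `houter`, so the surviving endpoint `n₁` is the inner one.
  -- Surviving steps then stay on the inner side.
  have hstart : ∀ d ∈ n₁.1.darts, M.Inner b p c i k d := by
    obtain ⟨x, hx, hxn⟩ := hn₁
    have hxd := h.hasColors_of_mk_eq (hx.trans hd₁.symm)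
    rw [hd₁i, hd₁k] at hxd
    have hxc := hxd.resolve_right (houter _ n₁.2 _ hxn)
    have := h.coloring.inner_of_lt (h.terminal_of_mem hxn).1 (by omega)
    rw [hxc.1, hxc.2] at this
    exact fun d hd => h.inner_of_mem hxn hd this
  have hstep : ∀ n m : ↥(deletedᶜ), (I.graph.induce deletedᶜ).Adj n m →
      (∀ d ∈ n.1.darts, M.Inner b p c i k d) → ∀ d ∈ m.1.darts, M.Inner b p c i k d := by
    rintro n m ⟨-, E, ⟨x, hx, hxn⟩, y, hy, hym⟩ hn d hd
    refine h.inner_of_mem hym hd ((h.coloring.inner_or_eq hik (Or.inl hu1) (hn _ hxn)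
      (h.terminal_of_mem hym).1 (h.terminal_of_mem hym).2
      (h.hasColors_of_mk_eq (hx.trans hy.symm))).resolve_right (houter _ m.2 _ hym))
  have hreach : (I.graph.induce deletedᶜ).Reachable n₁ n₂ :=
    (SimpleGraph.ConnectedComponent.eq.1 hC).symm
  have hend : ∀ d ∈ n₂.1.darts, M.Inner b p c i k d := by
    obtain ⟨w⟩ := hreach
    clear hC hn₁ hn₂
    induction w with
    | nil => exact hstart
    | cons hadj _ ih => exact ih (hstep _ _ hadj hstart)
  obtain ⟨x, hx, hxn⟩ := hn₂
  -- The deleted end of `E₂` is one edge away from an inner node. Inner nodes all survive, so it can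
  -- only be the outer end of `E₁`.
  rcases h.coloring.inner_or_eq hik (Or.inl hu1) (hend _ hxn) (h.terminal_of_mem hem).1
    (h.terminal_of_mem hem).2 (h.hasColors_of_mk_eq (hx.trans he₂.symm)) with hI | hI
  · exact (not_alive hem hm (hA.of_inner hD (h.terminal_of_mem hem).1 hI)).elim
  · rw [← hd₁, ← he₂]
    refine h.mk_eq_of_hasColors (Or.inr ?_)
    omega

theorem encard_dangling (h : I.IsCellColoring b p c)
    (hA : M.IsSurvival b p c (I.Alive deleted)) {i : ℕ} (hi : i < p) :
    ((i = 0 ∨ i = p - 1) →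
      {E | I.IsDangling deleted E ∧ I.Associated E (M.bdry b i)}.encard = 1) ∧
    (¬ (i = 0 ∨ i = p - 1) →
      {E | I.IsDangling deleted E ∧ I.Associated E (M.bdry b i)}.encard = 0 ∨
      {E | I.IsDangling deleted E ∧ I.Associated E (M.bdry b i)}.encard = 2) := by
  classical
  have hp := h.coloring.two_le
  have hmem : ∀ E, E ∈ {E | I.IsDangling deleted E ∧ I.Associated E (M.bdry b i)} →
      ∃ k, (M.Dangling b c (I.Alive deleted) i k ∨ M.Dangling b c (I.Alive deleted) k i) ∧
        ∃ d : {d : D // I.Bichromatic d}, Quot.mk I.Link d = E ∧ M.HasColors c d.1 i k := by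
    rintro E ⟨hE, e, he, hei⟩
    obtain ⟨x, y, hD, d, hd, hdx, hdy⟩ := h.exists_dangling hA hE
    rw [h.cell _ i hi] at hei
    have hed := h.hasColors_of_mk_eq (he.trans hd.symm)
    unfold HasColors at hed
    rw [hei, hdx, hdy] at hed
    rcases hed with ⟨rfl, -⟩ | ⟨rfl, -⟩
    · exact ⟨y, Or.inl hD, d, hd, Or.inl ⟨hdx, hdy⟩⟩
    · exact ⟨x, Or.inr hD, d, hd, Or.inr ⟨hdx, hdy⟩⟩
  have hof : ∀ k, (M.Dangling b c (I.Alive deleted) i k ∨ M.Dangling b c (I.Alive deleted) k i) →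
      ∃ E ∈ {E | I.IsDangling deleted E ∧ I.Associated E (M.bdry b i)},
        ∃ d : {d : D // I.Bichromatic d}, Quot.mk I.Link d = E ∧ M.HasColors c d.1 i k := by
    rintro k (hk | hk)
    · obtain ⟨d, hd, h1, h2⟩ := h.isDangling_of_dangling hk
      exact ⟨_, ⟨hd, d, rfl, (h.cell _ i hi).2 h1⟩, d, rfl, Or.inl ⟨h1, h2⟩⟩
    · obtain ⟨d, hd, h1, h2⟩ := h.isDangling_of_dangling hk
      obtain ⟨hr, hr'⟩ := (h.linkClosed (Quot.mk I.Link d)).rev d.1 ⟨d.2, rfl⟩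
      exact ⟨_, ⟨hd, ⟨M.rev d.1, hr⟩, hr', (h.cell _ i hi).2 h2⟩, d, rfl, Or.inr ⟨h1, h2⟩⟩
  have huniq : ∀ (E F : I.VEdge) (d e : {d : D // I.Bichromatic d}) (k : ℕ),
      Quot.mk I.Link d = E → M.HasColors c d.1 i k → Quot.mk I.Link e = F →
      M.HasColors c e.1 i k → E = F := fun E F d e k hdE hd heF he =>
    hdE.symm.trans ((h.mk_eq_of_hasColors (by unfold HasColors at *; omega)).trans heF)
  -- Upward and downward dangling edges at `i` number at most one each. Since `p ≥ 2`, their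
  -- difference is `±1` at the two extreme colours and `0` elsewhere, which settles all four cases.
  have hcount := h.coloring.exists_dangling_sub hA (i := i)
  by_cases hup : ∃ k, M.Dangling b c (I.Alive deleted) i k <;>
    by_cases hdown : ∃ k, M.Dangling b c (I.Alive deleted) k i
  · obtain ⟨k, hk⟩ := hup
    obtain ⟨l, hl⟩ := hdown
    rw [if_pos ⟨k, hk⟩, if_pos ⟨l, hl⟩] at hcount
    obtain ⟨E₁, hE₁, d, hdE, hd⟩ := hof k (Or.inl hk)
    obtain ⟨E₂, hE₂, e, heE, he⟩ := hof l (Or.inr hl)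
    refine ⟨fun h0 => ?_, fun _ => Or.inr ?_⟩
    · exfalso
      split_ifs at hcount <;> first | omega | norm_num at hcount
    · rw [show {E | I.IsDangling deleted E ∧ I.Associated E (M.bdry b i)} =
        {E₁, E₂} from ?_, Set.encard_pair]
      · intro hde
        have := h.hasColors_of_mk_eq (hdE.trans (hde.trans heE.symm))
        have h1 := hk.1
        have h2 := hl.1
        unfold HasColors at *
        omega
      · refine Set.Subset.antisymm (fun E hE => ?_) (Set.insert_subset hE₁ (Set.singleton_subset_iff.2 hE₂))
        obtain ⟨x, hx | hx, f, hfE, hf⟩ := hmem E hE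
        · obtain rfl := h.coloring.dangling_up_unique hA hk hx
          exact Or.inl (huniq _ _ _ _ _ hfE hf hdE hd)
        · obtain rfl := h.coloring.dangling_down_unique hA hl hx
          exact Or.inr (huniq _ _ _ _ _ hfE hf heE he)
  · obtain ⟨k, hk⟩ := hup
    rw [if_pos ⟨k, hk⟩, if_neg hdown] at hcount
    obtain ⟨E₁, hE₁, d, hdE, hd⟩ := hof k (Or.inl hk)
    refine ⟨fun _ => ?_, fun h0 => ?_⟩
    · rw [Set.encard_eq_one]
      refine ⟨E₁, Set.Subset.antisymm (fun E hE => ?_) (Set.singleton_subset_iff.2 hE₁)⟩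
      obtain ⟨x, hx | hx, f, hfE, hf⟩ := hmem E hE
      · obtain rfl := h.coloring.dangling_up_unique hA hk hx
        exact huniq _ _ _ _ _ hfE hf hdE hd
      · exact (hdown ⟨x, hx⟩).elim
    · exfalso
      split_ifs at hcount <;> first | omega | norm_num at hcount
  · obtain ⟨l, hl⟩ := hdown
    rw [if_neg hup, if_pos ⟨l, hl⟩] at hcount
    obtain ⟨E₂, hE₂, e, heE, he⟩ := hof l (Or.inr hl)
    refine ⟨fun _ => ?_, fun h0 => ?_⟩
    · rw [Set.encard_eq_one]
      refine ⟨E₂, Set.Subset.antisymm (fun E hE => ?_) (Set.singleton_subset_iff.2 hE₂)⟩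
      obtain ⟨x, hx | hx, f, hfE, hf⟩ := hmem E hE
      · exact (hup ⟨x, hx⟩).elim
      · obtain rfl := h.coloring.dangling_down_unique hA hl hx
        exact huniq _ _ _ _ _ hfE hf heE he
    · exfalso
      split_ifs at hcount <;> first | omega | norm_num at hcount
  · rw [if_neg hup, if_neg hdown] at hcount
    refine ⟨fun h0 => ?_, fun _ => Or.inl ?_⟩
    · exfalso
      split_ifs at hcount <;> first | omega | norm_num at hcount
    · rw [Set.encard_eq_zero, Set.eq_empty_iff_forall_notMem]
      intro E hE
      obtain ⟨x, hx | hx, -⟩ := hmem E hE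
      · exact hup ⟨x, hx⟩
      · exact hdown ⟨x, hx⟩

end IsCellColoring

end VoronoiInput

end

/-! ### Connectedness of Voronoi cells -/

section

open PlaneMap

namespace PlaneMap

variable {V D : Type*} {M : PlaneMap V D} {len : D → ℝ≥0∞}

theorem IsWalk.append {u v w : V} {l m : List D} (h : M.IsWalk u l v) (h' : M.IsWalk v m w) :
    M.IsWalk u (l ++ m) w := by
  induction h with
  | nil => exact h'
  | cons d _ ih => exact IsWalk.cons d (ih h')

theorem IsWalk.dist_le {u v : V} {l : List D} (h : M.IsWalk u l v) :
    M.dist len u v ≤ (l.map len).sum := iInf₂_le l h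

theorem IsWalk.dist_le_add (s : V) {u v : V} {l : List D} (h : M.IsWalk u l v) :
    M.dist len s v ≤ M.dist len s u + (l.map len).sum := by
  unfold dist
  rw [ENNReal.iInf_add]
  refine le_iInf fun m => ?_
  rw [ENNReal.iInf_add]
  refine le_iInf fun hm => ?_
  refine (iInf₂_le (m ++ l) (hm.append h)).trans ?_
  rw [List.map_append, List.sum_append]

theorem exists_isWalk (u v : V) : ∃ l, M.IsWalk u l v := by
  induction M.connected u v using Relation.ReflTransGen.head_induction_on with
  | refl => exact ⟨[], IsWalk.nil v⟩
  | head h _ ih =>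
    obtain ⟨d, rfl, rfl⟩ := h
    obtain ⟨l, hl⟩ := ih
    exact ⟨d :: l, IsWalk.cons d hl⟩

end PlaneMap

namespace VoronoiInput

variable {V D : Type*} {M : PlaneMap V D} (I : VoronoiInput M)

theorem wdist_le_add (s : V) {u v : V} {l : List D} (h : M.IsWalk u l v) :
    I.wdist s v ≤ I.wdist s u + (l.map I.len).sum := by
  unfold wdist
  rw [add_assoc]
  gcongr
  exact h.dist_le_add s

variable {I}

/-- If some vertex of the walk were at least as close to another site `t`, following the rest of the
walk would bring `t` too close to `v`. The bound `α` records the length already walked from `s`. -/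
theorem mem_cell_of_walk {s u v : V} (hs : s ∈ I.sites) {l : List D} (hl : M.IsWalk u l v)
    {α : ℝ≥0∞} (hu : I.wdist s u ≤ α)
    (hα : ∀ t ∈ I.sites, t ≠ s → α + (l.map I.len).sum < I.wdist t v) :
    Relation.ReflTransGen (M.Step fun d => M.src d ∈ I.cell s ∧ M.src (M.rev d) ∈ I.cell s) u v ∧
      u ∈ I.cell s := by
  have hmem : u ∈ I.cell s := ⟨hs, fun t ht hts => hu.trans_lt
    (lt_of_add_lt_add_right ((hα t ht hts).trans_le (I.wdist_le_add t hl)))⟩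
  refine ⟨?_, hmem⟩
  induction hl generalizing α with
  | nil => exact Relation.ReflTransGen.refl
  | @cons d l w hw ih =>
    have hd : I.wdist s (M.src (M.rev d)) ≤ α + I.len d := by
      have := I.wdist_le_add s (IsWalk.cons d (IsWalk.nil (M := M) (M.src (M.rev d))))
      simp only [List.map_cons, List.map_nil, List.sum_cons, List.sum_nil, add_zero] at this
      exact this.trans (by gcongr)
    have hα' : ∀ t ∈ I.sites, t ≠ s → α + I.len d + (l.map I.len).sum < I.wdist t w :=
      fun t ht hts => by
        have := hα t ht hts
        rwa [List.map_cons, List.sum_cons, ← add_assoc] at this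
    have hmem' : M.src (M.rev d) ∈ I.cell s := ⟨hs, fun t ht hts => hd.trans_lt
      (lt_of_add_lt_add_right ((hα' t ht hts).trans_le (I.wdist_le_add t hw)))⟩
    exact Relation.ReflTransGen.head ⟨d, ⟨hmem, hmem'⟩, rfl, rfl⟩ (ih hd hα' hmem')

/-- Voronoi cells are connected. -/
theorem cell_connected (hfin : I.sites.Finite) {s v : V} (hv : v ∈ I.cell s)
    (htop : I.wdist s v < ⊤) :
    Relation.ReflTransGen (M.Step fun d => M.src d ∈ I.cell s ∧ M.src (M.rev d) ∈ I.cell s) s v := by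
  classical
  -- Finitely many competitors leave a strict gap, so some actual walk from `s` beats all of them;
  -- attainment of the infimum that defines the distance is not needed.
  have hlt : I.wdist s v < (hfin.toFinset.erase s).inf (fun t => I.wdist t v) := by
    rw [Finset.lt_inf_iff htop]
    intro t ht
    rw [Finset.mem_erase, Set.Finite.mem_toFinset] at ht
    exact hv.2 t ht.2 ht.1
  have hex : ∃ l, M.IsWalk s l v ∧ I.weight s + (l.map I.len).sum <
      (hfin.toFinset.erase s).inf (fun t => I.wdist t v) := by
    by_contra! hcon
    refine hlt.not_ge ?_
    unfold wdist PlaneMap.dist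
    rw [ENNReal.add_iInf]
    refine le_iInf fun l => ?_
    rw [ENNReal.add_iInf]
    exact le_iInf fun hl => hcon l hl
  obtain ⟨l, hl, hl'⟩ := hex
  refine (mem_cell_of_walk hv.1 hl (α := I.weight s) ?_ fun t ht hts => hl'.trans_le ?_).1
  · have := (IsWalk.nil (M := M) s).dist_le (len := I.len)
    simp only [List.map_nil, List.sum_nil, nonpos_iff_eq_zero] at this
    rw [wdist, this, add_zero]
  · exact Finset.inf_le (Finset.mem_erase.2 ⟨hts, (Set.Finite.mem_toFinset _).2 ht⟩)

theorem exists_mem_cell (hfin : I.sites.Finite) (hne : I.sites.Nonempty) (hties : I.NoTies)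
    (v : V) : ∃ s ∈ I.sites, v ∈ I.cell s := by
  obtain ⟨s, hs, hmin⟩ := Set.exists_min_image I.sites (fun t => I.wdist t v) hfin hne
  exact ⟨s, hs, hs, fun t ht hts => lt_of_le_of_ne (hmin t ht) (hties s hs t ht hts.symm v)⟩

theorem cell_unique {s t v : V} (hs : v ∈ I.cell s) (ht : v ∈ I.cell t) : s = t := by
  by_contra hst
  exact lt_asymm (hs.2 t ht.1 (Ne.symm hst)) (ht.2 s hs.1 hst)

end VoronoiInput

/-- The hypotheses on the plane graph `X` and the sites on the face of `d₀`. -/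
structure IsMergeInput {V D : Type*} (X : PlaneMap V D) (len : D → ℝ≥0) (weight : V → ℝ≥0)
    (d₀ : D) (p q : ℕ) : Prop where
  two_le : 2 ≤ p
  one_le : 1 ≤ q
  card : (X.faceDarts (X.face d₀)).ncard = p + q
  simple : Set.InjOn X.src (X.faceDarts (X.face d₀))
  triangle : ∀ f, f ≠ X.face d₀ → X.IsTriangle f
  noTies : (fullInput X len weight d₀).NoTies
  mem_cell : ∀ s ∈ (fullInput X len weight d₀).sites, s ∈ (fullInput X len weight d₀).cell s

namespace IsMergeInput

variable {V D : Type*} {X : PlaneMap V D} {len : D → ℝ≥0} {weight : V → ℝ≥0} {d₀ : D} {p q : ℕ}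

theorem wdist_lt_top (s v : V) : (fullInput X len weight d₀).wdist s v < ⊤ := by
  obtain ⟨l, hl⟩ := X.exists_isWalk s v
  refine ENNReal.add_lt_top.2 ⟨ENNReal.coe_lt_top, (hl.dist_le).trans_lt ?_⟩
  clear hl
  induction l with
  | nil => simp
  | cons d l ih =>
    rw [List.map_cons, List.sum_cons]
    exact ENNReal.add_lt_top.2 ⟨ENNReal.coe_lt_top, ih⟩

section FiniteDarts

variable [Finite D]

theorem face_eq_iff (h : IsMergeInput X len weight d₀ p q) (d : D) :
    X.face d = X.face d₀ ↔ ∃ m < p + q, X.next^[m] d₀ = d := by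
  rw [X.face_eq_iff_iterate, ← X.ncard_faceDarts, h.card]

theorem bdry_injOn (h : IsMergeInput X len weight d₀ p q) :
    Set.InjOn (X.bdry d₀) (Set.Iio (p + q)) := fun m hm l hl hml => by
  refine Function.iterate_injOn_Iio_minimalPeriod (f := X.next) (x := d₀) ?_ ?_ ?_
  · rwa [← X.ncard_faceDarts, h.card]
  · rwa [← X.ncard_faceDarts, h.card]
  · exact h.simple (X.face_iterate d₀ m) (X.face_iterate d₀ l) hml

theorem mem_sites_iff (h : IsMergeInput X len weight d₀ p q) (v : V) :
    v ∈ (fullInput X len weight d₀).sites ↔ ∃ m < p + q, v = X.bdry d₀ m := by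
  constructor
  · rintro ⟨d, hd, rfl⟩
    obtain ⟨m, hm, rfl⟩ := (h.face_eq_iff d).1 hd
    exact ⟨m, hm, rfl⟩
  · rintro ⟨m, hm, rfl⟩
    exact ⟨_, X.face_iterate d₀ m, rfl⟩

theorem bdry_mem_cell (h : IsMergeInput X len weight d₀ p q) {m : ℕ} (hm : m < p + q) :
    X.bdry d₀ m ∈ (fullInput X len weight d₀).cell (X.bdry d₀ m) :=
  h.mem_cell _ ((h.mem_sites_iff _).2 ⟨m, hm, rfl⟩)

variable [Finite V]

theorem exists_owner (h : IsMergeInput X len weight d₀ p q) (v : V) :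
    ∃ m < p + q, v ∈ (fullInput X len weight d₀).cell (X.bdry d₀ m) := by
  obtain ⟨s, hs, hv⟩ := VoronoiInput.exists_mem_cell (Set.toFinite _)
    ⟨_, (h.mem_sites_iff _).2 ⟨0, by have := h.two_le; omega, rfl⟩⟩ h.noTies v
  obtain ⟨m, hm, rfl⟩ := (h.mem_sites_iff _).1 hs
  exact ⟨m, hm, hv⟩

/-- The owner of `v` among all sites decides. When it is red, the inequality stays strict because
the infimum over the finitely many green sites is attained. -/
theorem redCloser_iff (h : IsMergeInput X len weight d₀ p q) {m : ℕ} (hm : m < p + q) {v : V}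
    (hv : v ∈ (fullInput X len weight d₀).cell (X.bdry d₀ m)) :
    RedCloser X len weight d₀ p q v ↔ p ≤ m := by
  unfold RedCloser
  constructor
  · intro hlt
    by_contra! hmp
    refine hlt.not_ge ?_
    refine (iInf₂_le (X.bdry d₀ m) ⟨m, hmp, rfl⟩).trans (le_iInf₂ fun r hr => ?_)
    obtain ⟨j, hj, rfl⟩ := hr
    refine (hv.2 _ ((h.mem_sites_iff _).2 ⟨p + j, by omega, rfl⟩) fun hne => ?_).le
    have := h.bdry_injOn (show p + j < p + q by omega) hm hne
    omega
  · intro hpm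
    obtain ⟨g, ⟨j, hj, rfl⟩, hmin⟩ := Set.exists_min_image (greenSites X d₀ p)
      (fun t => (fullInput X len weight d₀).wdist t v) (Set.toFinite _)
      ⟨_, 0, by have := h.two_le; omega, rfl⟩
    refine (iInf₂_le (X.bdry d₀ m) ⟨m - p, by omega, by congr; omega⟩).trans_lt
      ((hv.2 (X.bdry d₀ j) ((h.mem_sites_iff _).2 ⟨j, by omega, rfl⟩) fun hne => ?_).trans_le
        (le_iInf₂ hmin))
    have := h.bdry_injOn (show j < p + q by omega) hm hne
    omega

end FiniteDarts

end IsMergeInput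

end

/-! ### Artificial edges -/

namespace IsAugmentation

variable {V D D' : Type*} {X : PlaneMap V D} {X' : PlaneMap V D'} {emb : D ↪ D'} {d₀ : D} {p : ℕ}
  {a : D'}

theorem next_iterate (haug : IsAugmentation X X' emb d₀ p a) {m : ℕ} (hm : m + 1 < p) :
    X'.next^[m] (emb d₀) = emb (X.next^[m] d₀) := by
  induction m with
  | zero => rfl
  | succ m ih =>
    rw [Function.iterate_succ_apply', ih (by omega), haug.next_bdry m (by omega)]

theorem next_iterate_last (haug : IsAugmentation X X' emb d₀ p a) (hp : 2 ≤ p) :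
    X'.next^[p - 1] (emb d₀) = a := by
  rw [show p - 1 = (p - 2) + 1 by omega, Function.iterate_succ_apply',
    haug.next_iterate (by omega), haug.next_last]

theorem period (haug : IsAugmentation X X' emb d₀ p a) (hp : 2 ≤ p) :
    X'.next^[p] (emb d₀) = emb d₀ := by
  rw [show p = (p - 1) + 1 by omega, Function.iterate_succ_apply', haug.next_iterate_last hp,
    haug.next_a]

theorem face_a (haug : IsAugmentation X X' emb d₀ p a) : X'.face a = X'.face (emb d₀) := by
  rw [← haug.next_a, X'.face_next]

theorem bdry_eq (haug : IsAugmentation X X' emb d₀ p a) {m : ℕ} (hm : m < p) :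
    X'.bdry (emb d₀) m = X.bdry d₀ m := by
  rcases m with _ | m
  · exact haug.src_emb d₀
  · unfold PlaneMap.bdry
    rw [Function.iterate_succ_apply', X'.src_next, haug.next_iterate (by omega), haug.rev_emb,
      haug.src_emb, Function.iterate_succ_apply', X.src_next]

theorem src_rev_a (haug : IsAugmentation X X' emb d₀ p a) : X'.src (X'.rev a) = X.bdry d₀ 0 := by
  rw [← X'.src_next, haug.next_a, haug.src_emb]
  rfl

theorem rev_mem_range (haug : IsAugmentation X X' emb d₀ p a) {x : D'} :
    X'.rev x ∈ Set.range emb ↔ x ∈ Set.range emb := by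
  constructor
  · rintro ⟨y, hy⟩
    exact ⟨X.rev y, by rw [← haug.rev_emb, hy, X'.rev_rev]⟩
  · rintro ⟨y, rfl⟩
    exact ⟨X.rev y, (haug.rev_emb y).symm⟩

variable (len : D → ℝ≥0)

/-- A walk in `X'` that uses an artificial dart has infinite length, and all others come from `X`.
-/
theorem dist_eq (haug : IsAugmentation X X' emb d₀ p a) (u v : V) :
    X'.dist (Function.extend emb (fun d => (len d : ℝ≥0∞)) (fun _ => ⊤)) u v =
      X.dist (fun d => (len d : ℝ≥0∞)) u v := by
  refine le_antisymm (le_iInf₂ fun l hl => ?_) (le_iInf₂ fun l hl => ?_)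
  · refine (iInf₂_le (l.map emb) ?_).trans ?_
    · induction hl with
      | nil => exact PlaneMap.IsWalk.nil _
      | cons d _ ih =>
        rw [List.map_cons, ← haug.src_emb]
        refine PlaneMap.IsWalk.cons (emb d) ?_
        rwa [haug.rev_emb, haug.src_emb]
    · rw [List.map_map]
      refine (congrArg List.sum (List.map_congr_left fun d _ => ?_)).le
      exact emb.injective.extend_apply _ _ d
  · induction hl with
    | nil => exact (PlaneMap.IsWalk.nil _).dist_le
    | @cons d l w _ ih =>
      rw [List.map_cons, List.sum_cons]
      by_cases hd : d ∈ Set.range emb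
      · obtain ⟨d, rfl⟩ := hd
        rw [emb.injective.extend_apply]
        rw [haug.rev_emb, haug.src_emb] at ih
        rw [haug.src_emb]
        refine le_trans ?_ (add_le_add_right ih _)
        unfold PlaneMap.dist
        rw [ENNReal.add_iInf]
        refine le_iInf fun m => ?_
        rw [ENNReal.add_iInf]
        refine le_iInf fun hm => ?_
        refine (PlaneMap.IsWalk.dist_le (PlaneMap.IsWalk.cons d hm)).trans ?_
        rw [List.map_cons, List.sum_cons]
      · rw [Function.extend_apply' _ _ _ hd, top_add]
        exact le_top

/-- Every artificial dart lies in the rotation of `X'` between two consecutive darts of `X`. -/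
theorem exists_gap [Finite D'] (haug : IsAugmentation X X' emb d₀ p a) {y : D'}
    (hy : y ∉ Set.range emb) :
    ∃ x : D, ∃ j, X'.rot^[j + 1] (emb x) = y ∧ ∀ l ≤ j, X'.rot^[l + 1] (emb x) ∉ Set.range emb := by
  obtain ⟨x₀, hx₀⟩ := X.src_surjective (X'.src y)
  obtain ⟨N, -, hN⟩ := ((X'.src_eq_iff (emb x₀) y).1 (by rw [haug.src_emb, hx₀])).exists_pow_eq'
  rw [← Equiv.Perm.iterate_eq_pow] at hN
  clear hx₀
  induction N using Nat.strong_induction_on generalizing x₀ with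
  | _ N ih =>
    obtain ⟨n, hn, hn'⟩ := haug.rot_emb x₀
    by_cases hNn : N ≤ n
    · rcases N with _ | N
      · exact (hy ⟨x₀, hN⟩).elim
      · exact ⟨x₀, N, hN, fun l hl => hn' l (by omega)⟩
    · refine ih (N - (n + 1)) (by omega) (X.rot x₀) ?_
      rw [← hn, ← Function.iterate_add_apply, show N - (n + 1) + (n + 1) = N by omega]
      exact hN

/-- Gaps occur only at the corners of the face of `d₀`. -/
theorem face_of_gap (haug : IsAugmentation X X' emb d₀ p a) {x : D}
    (hx : X'.rot (emb x) ∉ Set.range emb) : X.face x = X.face d₀ := by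
  by_contra hne
  have h1 : X.next (X.rev (X.rot x)) = x := by
    rw [X.next_rev]
    exact X.rot.symm_apply_apply x
  have h2 := haug.next_emb (X.rev (X.rot x)) (by rwa [← X.face_next, h1])
  rw [h1, ← haug.rev_emb, X'.next_rev] at h2
  refine hx ⟨X.rot x, ?_⟩
  rw [← h2]
  exact (X'.rot.apply_symm_apply _).symm

theorem rot_d₀ (haug : IsAugmentation X X' emb d₀ p a) : X'.rot (emb d₀) = X'.rev a := by
  rw [← haug.next_a, X'.rot_next]

theorem rot_a (haug : IsAugmentation X X' emb d₀ p a) :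
    X'.rot a = emb (X.rev (X.next^[p - 2] d₀)) := by
  rw [← haug.next_last, X'.rot_next, haug.rev_emb]

/-- At the green sites other than the first and the last, the corner of the hole belongs to `F'` and
contains no artificial dart. -/
theorem rot_iterate_mem (haug : IsAugmentation X X' emb d₀ p a) {m : ℕ} (hm : m + 2 < p) :
    X'.rot (emb (X.next^[m + 1] d₀)) ∈ Set.range emb := by
  rw [← haug.next_bdry m hm, X'.rot_next, haug.rev_emb]
  exact ⟨_, rfl⟩

end IsAugmentation

/-! ### Green cells and the outer side of a green circuit -/

section GreenCells

variable {V D D' : Type*} {X : PlaneMap V D} {X' : PlaneMap V D'} {emb : D ↪ D'} {len : D → ℝ≥0}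
  {weight : V → ℝ≥0} {d₀ : D} {p q : ℕ} {a : D'}

theorem IsAugmentation.wdist_eq (haug : IsAugmentation X X' emb d₀ p a) (s v : V) :
    (greenInput X X' emb len weight d₀ p a).wdist s v = (fullInput X len weight d₀).wdist s v :=
  congrArg ((weight s : ℝ≥0∞) + ·) (haug.dist_eq len s v)

/-- The function `c` maps a vertex to the index of the closest green site. -/
def IsGreenColor (X : PlaneMap V D) (X' : PlaneMap V D') (emb : D ↪ D') (len : D → ℝ≥0)
    (weight : V → ℝ≥0) (d₀ : D) (p : ℕ) (a : D') (c : V → ℕ) : Prop :=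
  ∀ v, c v < p ∧ v ∈ (greenInput X X' emb len weight d₀ p a).cell (X.bdry d₀ (c v))

namespace IsMergeInput

variable [Finite D]

theorem mem_green_cell (h : IsMergeInput X len weight d₀ p q)
    (haug : IsAugmentation X X' emb d₀ p a) {m : ℕ} (hm : m < p) {v : V}
    (hv : v ∈ (fullInput X len weight d₀).cell (X.bdry d₀ m)) :
    v ∈ (greenInput X X' emb len weight d₀ p a).cell (X.bdry d₀ m) := by
  refine ⟨⟨m, hm, rfl⟩, fun t ht hts => ?_⟩
  obtain ⟨j, hj, rfl⟩ := ht
  rw [haug.wdist_eq, haug.wdist_eq]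
  exact hv.2 _ ((h.mem_sites_iff _).2 ⟨j, by omega, rfl⟩) hts

variable [Finite V]

theorem exists_greenColor (h : IsMergeInput X len weight d₀ p q)
    (haug : IsAugmentation X X' emb d₀ p a) :
    ∃ c, IsGreenColor X X' emb len weight d₀ p a c := by
  have hp := h.two_le
  have key : ∀ v, ∃ i, i < p ∧
      v ∈ (greenInput X X' emb len weight d₀ p a).cell (X.bdry d₀ i) := fun v => by
    have hties : (greenInput X X' emb len weight d₀ p a).NoTies := by
      rintro s ⟨m, hm, rfl⟩ t ⟨l, hl, rfl⟩ hst w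
      rw [haug.wdist_eq, haug.wdist_eq]
      exact h.noTies _ ((h.mem_sites_iff _).2 ⟨m, by omega, rfl⟩) _
        ((h.mem_sites_iff _).2 ⟨l, by omega, rfl⟩) hst w
    have hne : (greenInput X X' emb len weight d₀ p a).sites.Nonempty :=
      ⟨X.bdry d₀ 0, 0, by omega, rfl⟩
    obtain ⟨s, ⟨m, hm, rfl⟩, hv⟩ :=
      VoronoiInput.exists_mem_cell (Set.toFinite _) hne hties v
    exact ⟨m, hm, hv⟩
  choose c hc using key
  exact ⟨c, hc⟩

end IsMergeInput

namespace IsGreenColor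

variable {c : V → ℕ} [Finite D]

theorem mem_cell_iff (hc : IsGreenColor X X' emb len weight d₀ p a c)
    (h : IsMergeInput X len weight d₀ p q) {v : V} {i : ℕ} (hi : i < p) :
    v ∈ (greenInput X X' emb len weight d₀ p a).cell (X.bdry d₀ i) ↔ c v = i := by
  constructor
  · intro hv
    have h1 := (hc v).1
    exact h.bdry_injOn (show c v < p + q by omega) (show i < p + q by omega)
      (VoronoiInput.cell_unique (hc v).2 hv)
  · rintro rfl
    exact (hc v).2

theorem eq_of_mem_cell (hc : IsGreenColor X X' emb len weight d₀ p a c)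
    (h : IsMergeInput X len weight d₀ p q) (haug : IsAugmentation X X' emb d₀ p a) {m : ℕ}
    (hm : m < p) {v : V} (hv : v ∈ (fullInput X len weight d₀).cell (X.bdry d₀ m)) : c v = m :=
  (hc.mem_cell_iff h hm).1 (h.mem_green_cell haug hm hv)

variable [Finite V]

theorem mem_cell_of_not_red (hc : IsGreenColor X X' emb len weight d₀ p a c)
    (h : IsMergeInput X len weight d₀ p q) (haug : IsAugmentation X X' emb d₀ p a) {v : V}
    (hv : ¬ RedCloser X len weight d₀ p q v) :
    v ∈ (fullInput X len weight d₀).cell (X.bdry d₀ (c v)) := by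
  obtain ⟨m, hm, hvm⟩ := h.exists_owner v
  rw [h.redCloser_iff hm hvm, not_le] at hv
  rwa [hc.eq_of_mem_cell h haug hv hvm]

theorem isCellColoring [Finite D'] (hc : IsGreenColor X X' emb len weight d₀ p a c)
    (h : IsMergeInput X len weight d₀ p q) (haug : IsAugmentation X X' emb d₀ p a) :
    (greenInput X X' emb len weight d₀ p a).IsCellColoring (emb d₀) p c where
  coloring :=
    { two_le := h.two_le
      period := haug.period h.two_le
      color_lt := fun v => (hc v).1
      color_bdry := fun m hm => by
        rw [haug.bdry_eq hm]
        exact hc.eq_of_mem_cell h haug hm (h.bdry_mem_cell (by omega))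
      triangle := fun f hf => haug.triangulated f (by rwa [haug.face_a])
      connected := fun v => by
        rw [haug.bdry_eq (hc v).1]
        refine PlaneMap.Step.mono (fun d hd => ?_) (VoronoiInput.cell_connected
          (I := greenInput X X' emb len weight d₀ p a) (Set.toFinite _) (hc v).2 ?_)
        · exact ⟨(hc.mem_cell_iff h (hc v).1).1 hd.1, (hc.mem_cell_iff h (hc v).1).1 hd.2⟩
        · rw [haug.wdist_eq]
          exact IsMergeInput.wdist_lt_top _ _ }
  hole := haug.face_a
  sameCell := fun u v => by
    constructor
    · rintro ⟨s, ⟨i, hi, rfl⟩, hu, hv⟩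
      rw [(hc.mem_cell_iff h hi).1 hu, (hc.mem_cell_iff h hi).1 hv]
    · intro huv
      exact ⟨_, ⟨c u, (hc u).1, rfl⟩, (hc u).2, huv ▸ (hc v).2⟩
  cell := fun v i hi => by
    rw [haug.bdry_eq hi]
    exact hc.mem_cell_iff h hi

/-- Both ends of `e` belong to green sites even in the full diagram, so the circuit can run inside
the full cells of the sites `i` and `k`. It then uses only darts of `X` and avoids red vertices. The
value `0` spreads from `a` along the rest of the boundary of `F`, from there through the connected
red cells, and to all artificial darts. -/
theorem exists_side (hc : IsGreenColor X X' emb len weight d₀ p a c) [Fintype D']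
    (h : IsMergeInput X len weight d₀ p q) (haug : IsAugmentation X X' emb d₀ p a) {i k : ℕ}
    (hik : i < k) {e : D} (hei : c (X.src e) = i) (hek : c (X.src (X.rev e)) = k)
    (he : ¬ RedCloser X len weight d₀ p q (X.src e))
    (he' : ¬ RedCloser X len weight d₀ p q (X.src (X.rev e))) :
    ∃ Ψ : D' → ℚ, (∀ d, X'.face d ≠ X'.face (emb d₀) → Ψ (X'.next d) = Ψ d) ∧
      (∀ d, i < c (X'.src d) → c (X'.src d) < k → Ψ d = 1) ∧
      (∀ d, RedCloser X len weight d₀ p q (X'.src d) → Ψ d = 0) ∧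
      (∀ d, d ∉ Set.range emb → Ψ d = 0) ∧
      ∀ m, p - 1 ≤ m → m < p + q → Ψ (emb (X.next^[m] d₀)) = 0 := by
  have hp := h.two_le
  have hq := h.one_le
  have hcol := (hc.isCellColoring h haug).coloring
  have hkp : k < p := hek ▸ (hc _).1
  have hse := haug.src_emb
  have hse' : ∀ d, X'.src (X'.rev (emb d)) = X.src (X.rev d) := fun d => by
    rw [haug.rev_emb, hse]
  -- Full cells, not green ones: a green cell may contain vertices closer to a red site and may have
  -- artificial edges between its vertices.
  let Q : D → Prop := fun x =>
    (X.src x ∈ (fullInput X len weight d₀).cell (X.bdry d₀ i) ∧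
      X.src (X.rev x) ∈ (fullInput X len weight d₀).cell (X.bdry d₀ i)) ∨
    (X.src x ∈ (fullInput X len weight d₀).cell (X.bdry d₀ k) ∧
      X.src (X.rev x) ∈ (fullInput X len weight d₀).cell (X.bdry d₀ k))
  have hQrev : ∀ x, Q x → Q (X.rev x) := fun x hx => by
    simp only [Q, X.rev_rev]
    exact hx.imp And.symm And.symm
  let S : D' → Prop := fun y => ∃ x, emb x = y ∧ Q x
  have hSrev : ∀ y, S y → S (X'.rev y) := by
    rintro _ ⟨x, rfl, hx⟩
    exact ⟨X.rev x, (haug.rev_emb x).symm, hQrev x hx⟩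
  have hcolQ : ∀ x, Q x → (c (X.src x) = i ∧ c (X.src (X.rev x)) = i) ∨
      (c (X.src x) = k ∧ c (X.src (X.rev x)) = k) := fun x hx =>
    hx.imp (fun hx => ⟨hc.eq_of_mem_cell h haug (by omega) hx.1,
      hc.eq_of_mem_cell h haug (by omega) hx.2⟩) (fun hx => ⟨hc.eq_of_mem_cell h haug hkp hx.1,
      hc.eq_of_mem_cell h haug hkp hx.2⟩)
  have hgreenQ : ∀ x, Q x → ¬ RedCloser X len weight d₀ p q (X.src x) := by
    rintro x (hx | hx)
    · rw [h.redCloser_iff (by omega) hx.1]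
      omega
    · rw [h.redCloser_iff (by omega) hx.1]
      omega
  have hlift : ∀ s u v, Relation.ReflTransGen (X.Step fun d =>
      X.src d ∈ (fullInput X len weight d₀).cell s ∧
      X.src (X.rev d) ∈ (fullInput X len weight d₀).cell s) u v →
      Relation.ReflTransGen (X'.Step fun y => ∃ x, emb x = y ∧
        X.src x ∈ (fullInput X len weight d₀).cell s ∧
        X.src (X.rev x) ∈ (fullInput X len weight d₀).cell s) u v := fun s u v huv =>
    Relation.ReflTransGen.mono (fun x y ⟨d, hd, hdx, hdy⟩ =>
      ⟨emb d, ⟨d, rfl, hd⟩, by rw [hse, hdx], by rw [hse', hdy]⟩) _ _ huv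
  have hconn : ∀ s v, v ∈ (fullInput X len weight d₀).cell s →
      Relation.ReflTransGen (X'.Step fun y => ∃ x, emb x = y ∧
        X.src x ∈ (fullInput X len weight d₀).cell s ∧
        X.src (X.rev x) ∈ (fullInput X len weight d₀).cell s) s v := fun s v hv =>
    hlift _ _ _ (VoronoiInput.cell_connected (Set.toFinite _) hv (IsMergeInput.wdist_lt_top _ _))
  have hei' := hc.mem_cell_of_not_red h haug he
  have hek' := hc.mem_cell_of_not_red h haug he'
  rw [hei] at hei'
  rw [hek] at hek'
  obtain ⟨Ψ, hΨ⟩ := X'.exists_isSide (b := emb d₀) (p := p) (S := S) (e := emb e) hik.le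
    hcol.injOn hkp.le hSrev
    (by
      rintro ⟨x, hx, hQ⟩
      obtain rfl := emb.injective hx
      have := hcolQ x hQ
      omega)
    (by
      rw [haug.bdry_eq (by omega), hse]
      exact PlaneMap.Step.mono (fun d ⟨x, hx, hd⟩ => ⟨x, hx, Or.inl hd⟩) (hconn _ _ hei'))
    (by
      rw [haug.bdry_eq hkp, hse']
      exact PlaneMap.Step.symm hSrev
        (PlaneMap.Step.mono (fun d ⟨x, hx, hd⟩ => ⟨x, hx, Or.inr hd⟩) (hconn _ _ hek')))
  have hart : ∀ y, y ∉ Set.range emb → Ψ y = Ψ (X'.rev y) := fun y hy => by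
    refine hΨ.same y ?_ ?_ ?_
    · rintro ⟨x, rfl, -⟩
      exact hy ⟨x, rfl⟩
    · rintro rfl
      exact hy ⟨e, rfl⟩
    · rintro rfl
      exact hy (haug.rev_mem_range.2 ⟨e, rfl⟩)
  have hredΨ : ∀ y, RedCloser X len weight d₀ p q (X'.src y) → Ψ y = Ψ (X'.rev y) := fun y hy => by
    refine hΨ.same y ?_ ?_ ?_
    · rintro ⟨x, rfl, hx⟩
      exact hgreenQ x hx (by rwa [hse] at hy)
    · rintro rfl
      exact he (by rwa [hse] at hy)
    · rintro rfl
      exact he' (by rwa [hse'] at hy)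
  have hredT : ∀ v, RedCloser X len weight d₀ p q v →
      v ≠ X'.bdry (emb d₀) i ∧ v ≠ X'.bdry (emb d₀) k := by
    have key : ∀ m, m < p → ¬ RedCloser X len weight d₀ p q (X'.bdry (emb d₀) m) := fun m hm => by
      rw [haug.bdry_eq hm, h.redCloser_iff (by omega) (h.bdry_mem_cell (by omega))]
      omega
    refine fun v hv => ⟨?_, ?_⟩
    · rintro rfl
      exact key i (by omega) hv
    · rintro rfl
      exact key k (by omega) hv
  have ha : Ψ a = 0 := by
    rw [← haug.next_iterate_last hp, hΨ.hole _ (by omega), if_neg (by omega)]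
  have hra : Ψ (X'.rev a) = 0 := by rw [← hart a haug.artificial, ha]
  -- `Ψ` does not jump across artificial edges, and off the hole it is constant along faces. This
  -- works even at the sites `i` and `k`, which lie on the circuit; `rev a` is excluded because its
  -- reverse `a` is on the hole.
  have hrot : ∀ z, X'.rot z ∉ Set.range emb → X'.rot z ≠ X'.rev a → Ψ (X'.rot z) = Ψ z := by
    intro z hz hza
    have hn : X'.next (X'.rev (X'.rot z)) = z := by
      rw [X'.next_rev]
      exact X'.rot.symm_apply_apply z
    rw [hart _ hz, ← hΨ.next, hn]
    intro hf
    obtain ⟨m, hm, hm'⟩ := (hcol.face_eq_iff _).1 hf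
    by_cases hmp : m + 1 < p
    · rw [haug.next_iterate hmp] at hm'
      exact hz (haug.rev_mem_range.1 ⟨_, hm'⟩)
    · obtain rfl : m = p - 1 := by omega
      rw [haug.next_iterate_last hp] at hm'
      exact hza (by rw [hm', X'.rev_rev])
  have hgap : ∀ (x : D) (j : ℕ), X.src x ≠ X.bdry d₀ 0 →
      (∀ l ≤ j, X'.rot^[l + 1] (emb x) ∉ Set.range emb) →
      Ψ (X'.rot^[j + 1] (emb x)) = Ψ (emb x) := by
    intro x j hx hj
    have hsrc : ∀ l, X'.src (X'.rot^[l] (emb x)) = X.src x := fun l => by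
      induction l with
      | zero => exact hse x
      | succ l ih => rw [Function.iterate_succ_apply', X'.src_rot, ih]
    have hstep : ∀ l ≤ j, Ψ (X'.rot^[l + 1] (emb x)) = Ψ (X'.rot^[l] (emb x)) := fun l hl => by
      have := hj l hl
      rw [Function.iterate_succ_apply'] at this ⊢
      refine hrot _ this fun hra => hx ?_
      rw [← hsrc (l + 1), Function.iterate_succ_apply', hra, haug.src_rev_a]
    induction j with
    | zero => exact hstep 0 le_rfl
    | succ j ih =>
      rw [hstep (j + 1) le_rfl]
      exact ih (fun l hl => hj l (by omega)) (fun l hl => hstep l (by omega))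
  have hinj : ∀ m, m < p + q → m ≠ 0 → X.src (X.next^[m] d₀) ≠ X.bdry d₀ 0 := fun m hm hm0 h0 =>
    hm0 (h.bdry_injOn hm (show 0 < p + q by omega) h0)
  -- At the last green site, `a` is the last artificial dart in the gap that follows this boundary
  -- dart, so the value `Ψ a = 0` carries over.
  have hlast : Ψ (emb (X.next^[p - 1] d₀)) = 0 := by
    obtain ⟨n, hn, hn'⟩ := haug.rot_emb (X.next^[p - 1] d₀)
    have hr : X.rot (X.next^[p - 1] d₀) = X.rev (X.next^[p - 2] d₀) := by
      rw [show p - 1 = (p - 2) + 1 by omega, Function.iterate_succ_apply', X.rot_next]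
    rw [hr, ← haug.rot_a, Function.iterate_succ_apply'] at hn
    have hn := X'.rot.injective hn
    rcases n with _ | n
    · exact (haug.artificial ⟨_, hn⟩).elim
    · rw [← ha, ← hn]
      exact (hgap _ n (hinj _ (by omega) (by omega)) fun l hl => hn' l (by omega)).symm
  have hfar : ∀ m, p - 1 + m < p + q → Ψ (emb (X.next^[p - 1 + m] d₀)) = 0 := by
    intro m
    induction m with
    | zero => exact fun _ => hlast
    | succ m ih =>
      intro hm
      have hsrc : X'.src (X'.rev (emb (X.next^[p - 1 + m] d₀))) = X.bdry d₀ (p - 1 + (m + 1)) := by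
        rw [hse', ← X.src_next, ← Function.iterate_succ_apply' X.next]
        rfl
      have hred : RedCloser X len weight d₀ p q
          (X'.src (X'.rev (emb (X.next^[p - 1 + m] d₀)))) := by
        rw [hsrc, h.redCloser_iff hm (h.bdry_mem_cell hm)]
        omega
      -- The next boundary vertex is a red site, hence off the circuit: neither crossing its edges
      -- nor turning around it changes `Ψ`.
      rw [← ih (by omega), ← X'.rev_rev (emb (X.next^[p - 1 + m] d₀)), ← hredΨ _ hred]
      refine (hΨ.eq_of_src_eq hcol hik hkp hredT hredΨ hred ?_).symm
      rw [hsrc, hse]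
      rfl
  have hfar' : ∀ m, p - 1 ≤ m → m < p + q → Ψ (emb (X.next^[m] d₀)) = 0 := fun m h1 h2 => by
    have := hfar (m - (p - 1)) (by omega)
    rwa [show p - 1 + (m - (p - 1)) = m by omega] at this
  refine ⟨Ψ, hΨ.next, fun d h1 h2 => ?_, fun d hd => ?_, fun d hd => ?_, hfar'⟩
  · rw [hΨ.eq_of_color hcol hik hkp ?_ (by rw [hse, hei]) (by rw [hse', hek]) (by omega) (by omega),
      if_pos ⟨h1, h2⟩]
    rintro _ ⟨x, rfl, hx⟩
    rw [hse]
    have := hcolQ x hx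
    omega
  · obtain ⟨m, hm, hvm⟩ := h.exists_owner (X'.src d)
    have hpm := (h.redCloser_iff hm hvm).1 hd
    rw [← hfar' m (by omega) hm]
    refine (hΨ.eq_of_walk hcol hik hkp hredT hredΨ (PlaneMap.Step.mono ?_ (hconn _ _ hvm))
      ((h.redCloser_iff hm (h.bdry_mem_cell hm)).2 hpm) (hse _) rfl).symm
    rintro _ ⟨x, rfl, hx⟩
    rw [hse, hse', h.redCloser_iff hm hx.1, h.redCloser_iff hm hx.2]
    exact ⟨hpm, hpm⟩
  · obtain ⟨x, j, rfl, hj⟩ := haug.exists_gap hd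
    obtain ⟨m, hm, rfl⟩ := (h.face_eq_iff x).1 (haug.face_of_gap (hj 0 (Nat.zero_le j)))
    -- At the first green site, the gap begins with `rev a`, where `Ψ` vanishes. The induction
    -- starts there because `Ψ (emb d₀)` itself is `1` when `i = 0`.
    rcases m with _ | m
    · clear hd
      induction j with
      | zero => exact (congrArg Ψ haug.rot_d₀).trans hra
      | succ j ih =>
        rw [← ih fun l hl => hj l (by omega), Function.iterate_succ_apply']
        refine hrot _ ?_ fun hr => ?_
        · rw [← Function.iterate_succ_apply' X'.rot]
          exact hj _ le_rfl
        · rw [← haug.rot_d₀] at hr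
          exact hj j (by omega) ⟨d₀, (X'.rot.injective hr).symm⟩
    · rw [hgap _ j (hinj _ hm (by omega)) hj]
      refine hfar' _ ?_ hm
      by_contra hlt
      exact hj 0 (Nat.zero_le j) (haug.rot_iterate_mem (by omega))

end IsGreenColor

end GreenCells

/-! ### Survival of nodes on the inner side -/

section Survival

variable {V D D' : Type*} {X : PlaneMap V D} {X' : PlaneMap V D'} {emb : D ↪ D'} {len : D → ℝ≥0}
  {weight : V → ℝ≥0} {d₀ : D} {p q : ℕ} {a : D'}

theorem IsAugmentation.exists_of_alive (haug : IsAugmentation X X' emb d₀ p a) {d : D'}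
    (hd : (greenInput X X' emb len weight d₀ p a).Alive
      (deletedNodes X X' emb len weight d₀ p q a) d) :
    ∃ x, emb x = d ∧ ¬ RedCloser X len weight d₀ p q (X.src x) ∧
      ¬ RedCloser X len weight d₀ p q (X.src (X.rev x)) := by
  have key : d ∈ Set.range emb ∧ ¬ RedCloser X len weight d₀ p q (X'.src d) ∧
      ¬ RedCloser X len weight d₀ p q (X'.src (X'.rev d)) := by
    obtain ⟨n, hdn, hn⟩ := hd
    cases n with
    | leaf y hy =>
      obtain rfl : d = y := hdn
      exact ⟨not_not.1 fun h => hn (Or.inl h), fun h => hn (Or.inr (Or.inl h)),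
        fun h => hn (Or.inr (Or.inr h))⟩
    | tri f hf =>
      obtain rfl : X'.face d = f := hdn
      refine ⟨?_, fun h => hn (Or.inr ⟨d, rfl, h⟩), fun h => hn (Or.inr ⟨X'.next d, ?_, ?_⟩)⟩
      · obtain ⟨f₀, hf₀⟩ := not_not.1 fun h => hn (Or.inl h)
        have : d ∈ X'.faceDarts (X'.face d) := rfl
        rw [hf₀] at this
        exact Set.image_subset_range _ _ this
      · exact X'.face_next d
      · rwa [X'.src_next]
  obtain ⟨⟨x, rfl⟩, h1, h2⟩ := key
  rw [haug.src_emb] at h1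
  rw [haug.rev_emb, haug.src_emb] at h2
  exact ⟨x, rfl, h1, h2⟩

namespace IsGreenColor

variable {c : V → ℕ} [Finite V] [Finite D] [Fintype D']

/-- The trichromatic faces with colours between those of a dart of a surviving node survive. -/
theorem not_deleted_of_between (hc : IsGreenColor X X' emb len weight d₀ p a c)
    (h : IsMergeInput X len weight d₀ p q) (haug : IsAugmentation X X' emb d₀ p a) {i k : ℕ}
    (hik : i < k) {x : D} (hx : X'.HasColors c (emb x) i k)
    (hr : ¬ RedCloser X len weight d₀ p q (X.src x))
    (hr' : ¬ RedCloser X len weight d₀ p q (X.src (X.rev x))) {e : D'}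
    (het : X'.Terminal (emb d₀) c e) (hef : X'.face e ≠ X'.face (emb d₀))
    (hcol : ∀ y, X'.face y = X'.face e → i ≤ c (X'.src y) ∧ c (X'.src y) ≤ k) :
    (∃ f₀ : X.Face, X'.faceDarts (X'.face e) = emb '' X.faceDarts f₀) ∧
      ∀ d ∈ X'.faceDarts (X'.face e), ¬ RedCloser X len weight d₀ p q (X'.src d) := by
  wlog hxi : c (X.src x) = i ∧ c (X.src (X.rev x)) = k generalizing x
  · have hx' : c (X.src x) = k ∧ c (X.src (X.rev x)) = i := by
      unfold PlaneMap.HasColors at hx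
      rw [haug.rev_emb, haug.src_emb, haug.src_emb] at hx
      exact hx.resolve_left hxi
    refine this (x := X.rev x) (Or.inl ?_) hr' (by rwa [X.rev_rev]) ?_
    · rw [haug.rev_emb, haug.src_emb, haug.src_emb, X.rev_rev]
      exact hx'.symm
    · rw [X.rev_rev]
      exact hx'.symm
  obtain ⟨Ψ, hnext, hmid, hred, hart, hfar⟩ := hc.exists_side h haug hik hxi.1 hxi.2 hr hr'
  have hcc := (hc.isCellColoring h haug).coloring
  have htri := hcc.triangle _ hef
  have h1 : Ψ (X'.next e) = Ψ e := hnext e hef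
  have h2 : Ψ (X'.next (X'.next e)) = Ψ e := by rw [hnext _ (by rwa [X'.face_next]), h1]
  -- Three different colours in `[i, k]` include one strictly between `i` and `k`, and `Ψ` is
  -- constant on the face. The face therefore has no artificial dart and no vertex closer to the red
  -- sites.
  have hone : Ψ e = 1 := by
    have c0 := hcol e rfl
    have c1 := hcol (X'.next e) (X'.face_next e)
    have c2 := hcol (X'.next (X'.next e)) (by rw [X'.face_next, X'.face_next])
    obtain ⟨t1, t2, t3⟩ := het.resolve_left hef
    by_cases m0 : i < c (X'.src e) ∧ c (X'.src e) < k
    · exact hmid e m0.1 m0.2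
    by_cases m1 : i < c (X'.src (X'.next e)) ∧ c (X'.src (X'.next e)) < k
    · rw [← h1]
      exact hmid _ m1.1 m1.2
    · rw [← h2]
      exact hmid _ (by omega) (by omega)
  have hall : ∀ d, X'.face d = X'.face e → Ψ d = 1 := fun d hd => by
    rcases htri.face_eq hd with rfl | rfl | rfl
    · exact hone
    · rw [h1, hone]
    · rw [h2, hone]
  refine ⟨?_, fun d hd hdr => ?_⟩
  · obtain ⟨y, rfl⟩ : e ∈ Set.range emb := by
      by_contra he
      rw [hart e he] at hone
      norm_num at hone
    -- A dart of `F` lies either on the green path, hence on the hole of `X'`, or on the remaining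
    -- arc, where `Ψ` vanishes.
    have hy : X.face y ≠ X.face d₀ := by
      intro hy
      obtain ⟨m, hm, rfl⟩ := (h.face_eq_iff y).1 hy
      by_cases hmp : m + 1 < p
      · rw [← haug.next_iterate hmp] at hef
        exact hef (X'.face_iterate _ m)
      · rw [hfar m (by omega) hm] at hone
        norm_num at hone
    have n1 := haug.next_emb y hy
    have n2 := haug.next_emb (X.next y) (by rwa [X.face_next])
    refine ⟨X.face y, Set.ext fun d => ⟨fun hd => ?_, ?_⟩⟩
    · rcases htri.face_eq hd with rfl | rfl | rfl
      · exact ⟨y, rfl, rfl⟩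
      · exact ⟨X.next y, X.face_next y, n1.symm⟩
      · exact ⟨X.next (X.next y), (X.face_next _).trans (X.face_next y), by rw [n1, n2]⟩
    · rintro ⟨z, hz, rfl⟩
      change X'.face (emb z) = X'.face (emb y)
      rcases (h.triangle _ hy).face_eq hz with rfl | rfl | rfl
      · rfl
      · rw [← n1, X'.face_next]
      · rw [← n2, ← n1, X'.face_next, X'.face_next]
  · have := hall d hd
    rw [hred d hdr] at this
    norm_num at this

theorem isSurvival (hc : IsGreenColor X X' emb len weight d₀ p a c)
    (h : IsMergeInput X len weight d₀ p q) (haug : IsAugmentation X X' emb d₀ p a) :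
    X'.IsSurvival (emb d₀) p c ((greenInput X X' emb len weight d₀ p a).Alive
      (deletedNodes X X' emb len weight d₀ p q a)) where
  next := by
    have key : ∀ d e, X'.face d ≠ X'.face (emb d₀) → X'.face e = X'.face d →
        (greenInput X X' emb len weight d₀ p a).Alive
          (deletedNodes X X' emb len weight d₀ p q a) d →
        (greenInput X X' emb len weight d₀ p a).Alive
          (deletedNodes X X' emb len weight d₀ p q a) e := by
      rintro d e hd he ⟨n, hdn, hn⟩
      cases n with
      | leaf y hy =>
        obtain rfl : d = y := hdn
        exact (hd (hy.1.trans haug.face_a)).elim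
      | tri f hf => exact ⟨.tri f hf, he.trans hdn, hn⟩
    refine fun d hd => ⟨key _ _ ?_ (X'.face_next d).symm, key _ _ hd (X'.face_next d)⟩
    rwa [X'.face_next]
  hole := by
    have hp := h.two_le
    have hcc := hc.isCellColoring h haug
    intro m hm
    constructor
    · intro hA
      by_contra hlt
      obtain rfl : m = p - 1 := by omega
      obtain ⟨x, hx, -⟩ := haug.exists_of_alive hA
      rw [haug.next_iterate_last hp] at hx
      exact haug.artificial ⟨x, hx⟩
    · intro hlt
      have hb : (greenInput X X' emb len weight d₀ p a).Bichromatic (X'.next^[m] (emb d₀)) := by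
        rw [hcc.bichromatic_iff, hcc.coloring.color_iterate hm, hcc.coloring.color_rev_iterate hlt]
        omega
      have hgreen : ∀ l < p, ¬ RedCloser X len weight d₀ p q (X'.bdry (emb d₀) l) := fun l hl => by
        rw [haug.bdry_eq hl, h.redCloser_iff (by omega) (h.bdry_mem_cell (by omega))]
        omega
      refine ⟨.leaf _ ⟨(X'.face_iterate _ m).trans haug.face_a.symm, hb⟩, rfl, ?_⟩
      rintro (hd | hd | hd)
      · rw [haug.next_iterate hlt] at hd
        exact hd ⟨_, rfl⟩
      · exact hgreen m hm hd
      · rw [← X'.src_next, ← Function.iterate_succ_apply' X'.next] at hd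
        exact hgreen (m + 1) hlt hd
  between := by
    intro d e i k hik _ hdA hdc het hef hcol
    have hcc := hc.isCellColoring h haug
    obtain ⟨x, rfl, hr, hr'⟩ := haug.exists_of_alive hdA
    obtain ⟨h1, h2⟩ := hc.not_deleted_of_between h haug hik hdc hr hr' het hef hcol
    refine ⟨.tri (X'.face e) ((hcc.trichromatic_iff hef).2 het), rfl, ?_⟩
    rintro (hd | ⟨y, hy, hyr⟩)
    · exact hd h1
    · exact h2 y hy hyr

end IsGreenColor

end Survival

theorem mainTheorem9 {V D D' : Type*} [Finite V] [Finite D] [Finite D']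
    (X : PlaneMap V D) (len : D → ℝ≥0) (hlen : ∀ d, len (X.rev d) = len d)
    (weight : V → ℝ≥0) (d₀ : D) (p q : ℕ) (hp : 2 ≤ p) (hq : 1 ≤ q)
    (hcard : (X.faceDarts (X.face d₀)).ncard = p + q)
    (hsimple : Set.InjOn X.src (X.faceDarts (X.face d₀)))
    (htri : ∀ f, f ≠ X.face d₀ → X.IsTriangle f)
    (hties : (fullInput X len weight d₀).NoTies)
    (hcell : ∀ s ∈ (fullInput X len weight d₀).sites, s ∈ (fullInput X len weight d₀).cell s)
    (X' : PlaneMap V D') (emb : D ↪ D') (a : D') (haug : IsAugmentation X X' emb d₀ p a) :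
    (∀ c, ((greenInput X X' emb len weight d₀ p a).danglingOf
        (deletedNodes X X' emb len weight d₀ p q a) c).Subsingleton) ∧
      ∀ i < p,
        ((i = 0 ∨ i = p - 1) →
          {E | (greenInput X X' emb len weight d₀ p a).IsDangling
              (deletedNodes X X' emb len weight d₀ p q a) E ∧
            (greenInput X X' emb len weight d₀ p a).Associated E (X.bdry d₀ i)}.encard = 1) ∧
        (¬ (i = 0 ∨ i = p - 1) →
          {E | (greenInput X X' emb len weight d₀ p a).IsDangling
              (deletedNodes X X' emb len weight d₀ p q a) E ∧
            (greenInput X X' emb len weight d₀ p a).Associated E (X.bdry d₀ i)}.encard = 0 ∨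
          {E | (greenInput X X' emb len weight d₀ p a).IsDangling
              (deletedNodes X X' emb len weight d₀ p q a) E ∧
            (greenInput X X' emb len weight d₀ p a).Associated E (X.bdry d₀ i)}.encard = 2) := by
  have h : IsMergeInput X len weight d₀ p q :=
    ⟨hp, hq, hcard, hsimple, htri, hties, hcell⟩
  have := Fintype.ofFinite D'
  obtain ⟨c, hc⟩ := h.exists_greenColor haug
  have hcc := hc.isCellColoring h haug
  have hA := hc.isSurvival h haug
  refine ⟨hcc.danglingOf_subsingleton hA, fun i hi => ?_⟩
  rw [← haug.bdry_eq hi]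
  exact hcc.encard_dangling hA hi
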